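/- Let $L_1,L_2,C_1,C_2,C_{sc},R_1,R_2,G,G_{sc}>0$, $I_L\in\mathbb R$ and $0<u_m<u_M\le 1$. Consider, on $t\ge 0$, the converter $$\begin{aligned} L_1\dot x_1&=-R_1x_1+x_5-x_2u_1,\\ C_1\dot x_2&=-Gx_2+x_1u_1-x_3u_2,\\ L_2\dot x_3&=-R_2x_3-x_4+x_2u_2,\\ C_2\dot x_4&=x_3-I_L,\\ C_{sc}\dot x_5&=-G_{sc}x_5-x_1,\end{aligned}\tag{1}$$ where the control signals $u_1,u_2$ are arbitrary measurable functions of time with values in $[u_m,u_M]$. Signals live in the extended space $\mathcal L_{2e}$; write $\langle f,g\rangle_T=\int_0^Tfg\,dt$ and $\|f\|_{2,T}=(\int_0^Tf^2dt)^{1/2}$. Let $\bar\Sigma_1: w\mapsto \xi_1$ be the LTI system $L_2\dot\xi_1=-R_2\xi_1-\xi_2+w$, $C_2\dot\xi_2=\xi_1$; let $\bar\Sigma_1^M: v\mapsto y=u_2\cdot\bar\Sigma_1(u_2v)$; and let $\bar\Sigma_2:e\mapsto x_2$ be the system $$L_1\dot x_1=-R_1x_1+x_5-x_2u_1,\qquad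 C_1\dot x_2=-Gx_2+x_1u_1+e,\qquad C_{sc}\dot x_5=-G_{sc}x_5-x_1 .$$ Then the following hold. 1. $\bar\Sigma_1$ has the transfer function $F(s)=\dfrac{s}{L_2s^2+R_2s+1/C_2}$, which has no poles in $\mathrm{Re}\,s\ge 0$, is positive real, and satisfies $\mathrm{Re}\,F(s)>0$ for all $s\ne0$ with $\mathrm{Re}\,s\ge0$. 2. For each constant control $u_1\equiv a\in[u_m,u_M]$ the transfer function of $\bar\Sigma_2$ is strictly positive real (SPR), i.e. $s\mapsto F_a(s-\varepsilon)$ is positive real for some $\varepsilon>0$. 3. There are constants $\delta_1,\delta_2,\gamma_0,\gamma>0$ and a positive function $\beta$ of the initial state, all independent of the controls, such that for all control signals $u_1,u_2$: (a) $\bar\Sigma_1^M:v\mapsto y$ is, for every initial state, a well-defined causal operator on $\mathcal L_{2e}$, and it is output strictly passive: $\langle v,y\rangle_T\ge\delta_1\|y\|_{2,T}^2-b$ for all $T\ge 0$, where $b$ does not depend on $v$ and $T$. (b) $\bar\Sigma_2:e\mapsto x_2$ is, for every initial state, a well-defined causal operator on $\mathcal L_{2e}$. With $H_2=\frac12(L_1x_1^2+C_1x_2^2+C_{sc}x_5^2)$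 and $d_2=R_1x_1^2+Gx_2^2+G_{sc}x_5^2$ it satisfies the energy balance $H_2(T)-H_2(0)=-\int_0^Td_2\,dt+\int_0^Tx_2\,e\,dt$ for all $T\ge0$. It is strictly passive, i.e. $\dot V+\psi\le e\,x_2$ (in integrated form) along all trajectories, for some $C^1$ storage function $V\ge0$ and some continuous positive definite function $\psi$ of the state. It is also output strictly passive with constant $\delta_2$. (c) System (1) is the negative feedback interconnection of these two operators with external input $r(t)=\frac{I_L}{C_2}\frac{t}{u_2(t)}$. That is, for every initial state $x(0)$, signals $v,y,z$ satisfy $v=r+z$, $y=\bar\Sigma_1^Mv$ with initial state $(x_3(0),x_4(0))$, and $z=\bar\Sigma_2(-y)$ with initial state $(x_1(0),x_2(0),x_5(0))$, if and only if $v=r+x_2$, $y=u_2x_3$, $z=x_2$ on $t\ge0$ for a solution $x$ of (1) with that initial state. (d) The closed-loop operator $r\mapsto y$ (for arbitrary $r\in\mathcal L_{2e}$) is well defined, causal and $\mathcal L_2$-stable: $\|y\|_{2,T}\le\gamma_0\|r\|_{2,T}+\beta$ for all $T\ge0$. In particular, along every solution of (1), for all $T\ge0$, $y=u_2x_3$ satisfies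 $$\|y\|_{2,T}\le\gamma\left\|\frac{t}{u_2(t)}\right\|_{2,T}+\beta .$$ -/

import Mathlib

open MeasureTheory Set Matrix

noncomputable section

namespace Converter

/-! ### Signals and operators on the extended space of square-integrable signals -/

/-- The extended space of signals on the half-line of nonnegative times which are
square integrable on every bounded interval starting at time zero. -/
def MemL2e (f : ℝ → ℝ) : Prop :=
  ∀ T : ℝ, MemLp f 2 (volume.restrict (Icc 0 T))

/-- Truncated inner product of two signals. -/
def innerT (T : ℝ) (f g : ℝ → ℝ) : ℝ := ∫ t in (0 : ℝ)..T, f t * g t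

/-- Truncated norm of a signal. -/
def normT (T : ℝ) (f : ℝ → ℝ) : ℝ := √(∫ t in (0 : ℝ)..T, f t ^ 2)

/-- An input-output operator with initial conditions in `X`, given by its graph: `H x₀ u y` says
that `y` is an output for the initial condition `x₀` and the input `u`. -/
abbrev Op (X : Type) := X → (ℝ → ℝ) → (ℝ → ℝ) → Prop

/-- The graph `H` is that of a causal operator from the extended space to itself: every input has
an output, and the output up to time `T` is determined by the input up to time `T`. -/
def IsCausalOperator {X : Type} (H : Op X) : Prop :=
  (∀ x₀ u, MemL2e u → ∃ y, MemL2e y ∧ H x₀ u y) ∧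
  ∀ x₀ u u' y y' T, 0 ≤ T → H x₀ u y → H x₀ u' y' →
    (∀ t ∈ Icc (0 : ℝ) T, u t = u' t) → ∀ t ∈ Icc (0 : ℝ) T, y t = y' t

/-- Output strict passivity with constant `δ`; the bias depends on the initial condition only. -/
def OutputStrictlyPassive {X : Type} (δ : ℝ) (H : Op X) : Prop :=
  0 < δ ∧ ∀ x₀, ∃ b : ℝ, ∀ u y, H x₀ u y → ∀ T : ℝ, 0 ≤ T →
    δ * normT T y ^ 2 - b ≤ innerT T u y

/-- Finite-gain stability with gain `γ` and bias `β x₀`. -/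
def FiniteGainStable {X : Type} (γ : ℝ) (β : X → ℝ) (H : Op X) : Prop :=
  ∀ x₀ u y, H x₀ u y → ∀ T : ℝ, 0 ≤ T → normT T y ≤ γ * normT T u + β x₀

/-- Pre- and post-multiplication of an operator by the signal `m`. -/
def prePostMul {X : Type} (m : ℝ → ℝ) (H : Op X) : Op X := fun x₀ v y =>
  MemL2e v ∧ ∃ z, H x₀ (fun t => m t * v t) z ∧ ∀ t, 0 ≤ t → y t = m t * z t

/-- All the signals of the negative feedback interconnection of `H₁ : v ↦ y` and `H₂ : -y ↦ z`,
with `v = r + z` and external input `r`. -/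
def FeedbackLoop {X₁ X₂ : Type} (H₁ : Op X₁) (H₂ : Op X₂) (x₀ : X₁ × X₂)
    (r v y z : ℝ → ℝ) : Prop :=
  MemL2e r ∧ (∀ t, 0 ≤ t → v t = r t + z t) ∧
    H₁ x₀.1 v y ∧ H₂ x₀.2 (fun t => - y t) z

/-- The closed-loop operator `r ↦ y` of the feedback interconnection. -/
def closedLoop {X₁ X₂ : Type} (H₁ : Op X₁) (H₂ : Op X₂) : Op (X₁ × X₂) :=
  fun x₀ r y => ∃ v z, FeedbackLoop H₁ H₂ x₀ r v y z

/-! ### State-space systems -/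

/-- Caratheodory solution on `[0, ∞)` of `x' = f t x` (absolutely continuous, with the equation
holding almost everywhere), in integral form. -/
def IsSolution {n : ℕ} (f : ℝ → (Fin n → ℝ) → (Fin n → ℝ)) (x : ℝ → Fin n → ℝ) : Prop :=
  ∀ i, ∀ t, 0 ≤ t → IntervalIntegrable (fun s => f s (x s) i) volume 0 t ∧
    x t i = x 0 i + ∫ s in (0 : ℝ)..t, f s (x s) i

/-- A linear, possibly time-varying, single-input single-output system
`x' = A(t) x + b u`, `y = c x`. -/
structure LinSys (n : ℕ) where
  A : ℝ → Matrix (Fin n) (Fin n) ℝ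
  b : Fin n → ℝ
  c : Fin n → ℝ

/-- State trajectories for the input `u`. -/
def LinSys.IsTrajectory {n : ℕ} (S : LinSys n) (u : ℝ → ℝ) (x : ℝ → Fin n → ℝ) : Prop :=
  IsSolution (fun t ξ => S.A t *ᵥ ξ + u t • S.b) x

/-- The input-output operator of a linear system, parametrized by the initial state. -/
def LinSys.op {n : ℕ} (S : LinSys n) : Op (Fin n → ℝ) := fun x₀ u y =>
  MemL2e u ∧ ∃ x, S.IsTrajectory u x ∧ x 0 = x₀ ∧ ∀ t, 0 ≤ t → y t = S.c ⬝ᵥ x t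

/-- Strict passivity of a state-space system: there are a continuously differentiable nonnegative
storage function `V` and a continuous positive definite function `ψ` such that `V' + ψ(x) ≤ u y`
along all trajectories (in integrated form). -/
def LinSys.StrictlyPassive {n : ℕ} (S : LinSys n) : Prop :=
  ∃ V ψ : (Fin n → ℝ) → ℝ, ContDiff ℝ 1 V ∧ V 0 = 0 ∧ (∀ ξ, 0 ≤ V ξ) ∧
    Continuous ψ ∧ ψ 0 = 0 ∧ (∀ ξ, ξ ≠ 0 → 0 < ψ ξ) ∧
    ∀ u x, MemL2e u → S.IsTrajectory u x → ∀ s t, 0 ≤ s → s ≤ t →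
      V (x t) - V (x s) + ∫ τ in s..t, ψ (x τ) ≤ ∫ τ in s..t, u τ * (S.c ⬝ᵥ x τ)

/-- The transfer function `c (s I - A)⁻¹ b` of the time-invariant system `(A, b, c)`. -/
def transferFunction {n : ℕ} (A : Matrix (Fin n) (Fin n) ℝ) (b c : Fin n → ℝ) (s : ℂ) : ℂ :=
  (fun i => (c i : ℂ)) ⬝ᵥ
    ((s • (1 : Matrix (Fin n) (Fin n) ℂ) - A.map (fun a => (a : ℂ)))⁻¹ *ᵥ fun i => (b i : ℂ))

/-- Positive real functions: analytic in the open right half-plane, real on the positive real axis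
and with nonnegative real part in the open right half-plane. -/
def PositiveReal (F : ℂ → ℂ) : Prop :=
  DifferentiableOn ℂ F {s | 0 < s.re} ∧ (∀ a : ℝ, 0 < a → (F a).im = 0) ∧
    ∀ s : ℂ, 0 < s.re → 0 ≤ (F s).re

/-- Strictly positive real (SPR) functions: `s ↦ F (s - ε)` is positive real for some `ε > 0`. -/
def StrictlyPositiveReal (F : ℂ → ℂ) : Prop :=
  ∃ ε : ℝ, 0 < ε ∧ PositiveReal (fun s => F (s - ε))

/-! ### The converter -/

/-- The physical parameters of the circuit. -/
structure Params where
  L₁ : ℝ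
  L₂ : ℝ
  C₁ : ℝ
  C₂ : ℝ
  Csc : ℝ
  R₁ : ℝ
  R₂ : ℝ
  G : ℝ
  Gsc : ℝ
  L₁_pos : 0 < L₁
  L₂_pos : 0 < L₂
  C₁_pos : 0 < C₁
  C₂_pos : 0 < C₂
  Csc_pos : 0 < Csc
  R₁_pos : 0 < R₁
  R₂_pos : 0 < R₂
  G_pos : 0 < G
  Gsc_pos : 0 < Gsc

/-- Admissible control signals: measurable in time with values in `[um, uM]`. -/
def IsControl (um uM : ℝ) (u : ℝ → ℝ) : Prop :=
  AEMeasurable u (volume.restrict (Ici 0)) ∧ ∀ t, 0 ≤ t → u t ∈ Icc um uM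

/-- The vector field of the converter; the entries `0, …, 4` of the state are the
variables `x₁, …, x₅`. -/
def Params.field (p : Params) (I_L : ℝ) (u₁ u₂ : ℝ → ℝ) (t : ℝ) (x : Fin 5 → ℝ) : Fin 5 → ℝ :=
  ![(-p.R₁ * x 0 + x 4 - x 1 * u₁ t) / p.L₁,
    (-p.G * x 1 + x 0 * u₁ t - x 2 * u₂ t) / p.C₁,
    (-p.R₂ * x 2 - x 3 + x 1 * u₂ t) / p.L₂,
    (x 2 - I_L) / p.C₂,
    (-p.Gsc * x 4 - x 0) / p.Csc]

/-- The states `(x₃, x₄)` and `(x₁, x₂, x₅)` of the two subsystems. -/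
def splitState (x : Fin 5 → ℝ) : (Fin 2 → ℝ) × (Fin 3 → ℝ) :=
  (![x 2, x 3], ![x 0, x 1, x 4])

/-- The time-invariant system `L₂ ξ₁' = -R₂ ξ₁ - ξ₂ + w`, `C₂ ξ₂' = ξ₁`, with output `ξ₁`. -/
def Params.sys1 (p : Params) : LinSys 2 where
  A := fun _ => !![-p.R₂ / p.L₂, -1 / p.L₂; 1 / p.C₂, 0]
  b := ![1 / p.L₂, 0]
  c := ![1, 0]

/-- The transfer function `s / (L₂ s² + R₂ s + 1/C₂)`. -/
def Params.tf1 (p : Params) (s : ℂ) : ℂ :=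
  s / ((p.L₂ : ℂ) * s ^ 2 + p.R₂ * s + 1 / p.C₂)

/-- The operator `v ↦ y = u₂ · Σ₁ (u₂ · v)`. -/
def Params.op1 (p : Params) (u₂ : ℝ → ℝ) : Op (Fin 2 → ℝ) := prePostMul u₂ p.sys1.op

/-- State matrix of the second subsystem for the value `a` of the control `u₁`. -/
def Params.A2 (p : Params) (a : ℝ) : Matrix (Fin 3) (Fin 3) ℝ :=
  !![-p.R₁ / p.L₁, -a / p.L₁, 1 / p.L₁;
     a / p.C₁, -p.G / p.C₁, 0;
     -1 / p.Csc, 0, -p.Gsc / p.Csc]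

/-- The system `L₁ x₁' = -R₁ x₁ + x₅ - x₂ u₁`, `C₁ x₂' = -G x₂ + x₁ u₁ + e`,
`Csc x₅' = -Gsc x₅ - x₁` with state `(x₁, x₂, x₅)`, input `e = -y` and output `x₂`. -/
def Params.sys2 (p : Params) (u₁ : ℝ → ℝ) : LinSys 3 where
  A := fun t => p.A2 (u₁ t)
  b := ![0, 1 / p.C₁, 0]
  c := ![0, 1, 0]

/-- Total co-energy of the second subsystem. -/
def Params.H2 (p : Params) (ξ : Fin 3 → ℝ) : ℝ :=
  (p.L₁ * ξ 0 ^ 2 + p.C₁ * ξ 1 ^ 2 + p.Csc * ξ 2 ^ 2) / 2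

/-- Dissipation of the second subsystem. -/
def Params.d2 (p : Params) (ξ : Fin 3 → ℝ) : ℝ :=
  p.R₁ * ξ 0 ^ 2 + p.G * ξ 1 ^ 2 + p.Gsc * ξ 2 ^ 2

/-- The external input `(I_L / C₂) · t / u₂(t)` of the feedback interconnection. -/
def Params.extInput (p : Params) (I_L : ℝ) (u₂ : ℝ → ℝ) (t : ℝ) : ℝ :=
  I_L / p.C₂ * (t / u₂ t)

end Converter

end

open MeasureTheory Set Matrix

noncomputable section

namespace Converter

/-! ### Energy rule for absolutely continuous functions -/

/-! The proof is an energy argument. In both subsystems the couplings between storage elements are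
lossless: in the power balance every cross term, including those carrying `u₁`, occurs twice with
opposite signs. The stored energy thus changes only by resistive dissipation and supplied power,
which yields the passivity constants `R₂` and `G`, independent of the controls (`sys1_energy`,
`sys2_energy`). Multiplication by `u₂` on both sides keeps passivity, since ⟨v, u₂ξ₁⟩ = ⟨u₂v, ξ₁⟩,
and |u₂| ≤ 1 gives ‖u₂ξ₁‖ ≤ ‖ξ₁‖.

Around the loop ⟨v, y⟩ + ⟨-y, z⟩ = ⟨r, y⟩, so adding the two passivity inequalities bounds R₂‖y‖² by
⟨r, y⟩ plus the initial energy; Young's inequality turns this into gain 1/R₂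
(`normT_le_of_feedbackLoop`). The current `I_L` enters as a ramp added to `x₄`, which explains the
external input t/u₂ (`feedbackLoop_extInput_iff`).

Well-posedness reduces to linear equations with bounded measurable coefficients: the Peano–Baker
series gives solutions, and the same factorial estimate gives uniqueness up to each time T, hence
causality. The frequency-domain claims hold because the transfer functions are inverses of
impedances or admittances built from sums and inverses, which preserve positive real part. -/

theorem sq_sub_sq_eq_integral {x f : ℝ → ℝ} {T : ℝ} (hT : 0 ≤ T)
    (hf : IntervalIntegrable f volume 0 T)
    (hx : ∀ t ∈ Icc 0 T, x t = x 0 + ∫ s in (0 : ℝ)..t, f s) :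
    x T ^ 2 - x 0 ^ 2 = ∫ t in (0 : ℝ)..T, 2 * (x t * f t) := by
  set F : ℝ → ℝ := fun t => ∫ s in (0 : ℝ)..t, f s with hF
  have hac : AbsolutelyContinuousOnInterval F 0 T :=
    hf.absolutelyContinuousOnInterval_intervalIntegral (by simp)
  have hder : ∀ᵐ t, t ∈ uIoc 0 T → deriv F t = f t := by
    filter_upwards [hf.ae_hasDerivAt_integral] with t ht htT
    exact (ht (uIoc_subset_uIcc htT) 0 (by simp)).deriv
  -- Integration by parts of the primitive `F` against itself; the constant `x 0` contributes a
  -- cross term, handled in `h3`.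
  have h1 := hac.integral_deriv_mul_eq_sub hac
  have h2 : ∫ t in (0 : ℝ)..T, (deriv F t * F t + F t * deriv F t)
      = ∫ t in (0 : ℝ)..T, 2 * (F t * f t) := by
    refine intervalIntegral.integral_congr_ae ?_
    filter_upwards [hder] with t ht htT
    rw [ht htT]; ring
  have hcont : ContinuousOn F (uIcc 0 T) := hac.continuousOn
  have h3 : ∫ t in (0 : ℝ)..T, 2 * (x t * f t)
      = ∫ t in (0 : ℝ)..T, (2 * (F t * f t) + 2 * x 0 * f t) := by
    refine intervalIntegral.integral_congr fun t ht => ?_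
    rw [uIcc_of_le hT] at ht
    simp only [hx t ht, hF]; ring
  have hi : IntervalIntegrable (fun t => 2 * (F t * f t)) volume 0 T :=
    (hf.continuousOn_mul hcont).const_mul 2
  rw [h3, intervalIntegral.integral_add hi (hf.const_mul _),
    intervalIntegral.integral_const_mul (2 * x 0), ← h2, h1, hx T ⟨hT, le_rfl⟩]
  simp only [hF, intervalIntegral.integral_same]
  ring

/-! ### Linear Volterra equations -/

section Volterra

variable {E : Type*} [NormedAddCommGroup E] [NormedSpace ℝ E]

theorem aestronglyMeasurable_clm_apply {A : ℝ → E →L[ℝ] E} {f : ℝ → E} {T : ℝ}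
    (hA : AEStronglyMeasurable A (volume.restrict (Ici 0))) (hf : ContinuousOn f (Icc 0 T)) :
    AEStronglyMeasurable (fun s => A s (f s)) (volume.restrict (Icc 0 T)) := by
  have h1 : AEStronglyMeasurable A (volume.restrict (Icc 0 T)) :=
    hA.mono_measure (Measure.restrict_mono Icc_subset_Ici_self le_rfl)
  have h2 : AEStronglyMeasurable f (volume.restrict (Icc 0 T)) :=
    hf.aestronglyMeasurable_of_isCompact isCompact_Icc measurableSet_Icc
  exact (ContinuousLinearMap.apply ℝ E).flip.aestronglyMeasurable_comp₂ h1 h2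

theorem intervalIntegrable_clm_apply {A : ℝ → E →L[ℝ] E} {f : ℝ → E} {K T t : ℝ}
    (hA : AEStronglyMeasurable A (volume.restrict (Ici 0))) (hK : ∀ t, 0 ≤ t → ‖A t‖ ≤ K)
    (hf : ContinuousOn f (Icc 0 T)) (ht : t ∈ Icc 0 T) :
    IntervalIntegrable (fun s => A s (f s)) volume 0 t := by
  obtain ⟨M, hM⟩ := isCompact_Icc.exists_bound_of_continuousOn hf
  have h : IntegrableOn (fun s => A s (f s)) (Icc 0 T) := by
    refine IntegrableOn.of_bound (C := K * M) (by simp)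
      (aestronglyMeasurable_clm_apply hA hf) ?_
    filter_upwards [ae_restrict_mem measurableSet_Icc] with s hs
    exact (A s).le_of_opNorm_le_of_le (hK s hs.1) (hM s hs)
  rw [intervalIntegrable_iff_integrableOn_Icc_of_le ht.1]
  exact h.mono_set (Icc_subset_Icc_right ht.2)

/-- One integration raises the power of Kt by one and contributes the factor 1/(k+1). This is the
induction step for both uniqueness and convergence of the series. -/
theorem norm_integral_clm_apply_le {A : ℝ → E →L[ℝ] E} {f : ℝ → E} {K T M t : ℝ} {k : ℕ}
    (hK : ∀ t, 0 ≤ t → ‖A t‖ ≤ K)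
    (hf : ∀ s ∈ Icc 0 T, ‖f s‖ ≤ M * ((K * s) ^ k / k.factorial)) (ht : t ∈ Icc 0 T) :
    ‖∫ s in (0 : ℝ)..t, A s (f s)‖ ≤ M * ((K * t) ^ (k + 1) / (k + 1).factorial) := by
  have h1 : ‖∫ s in (0 : ℝ)..t, A s (f s)‖
      ≤ ∫ s in (0 : ℝ)..t, K * (M * ((K * s) ^ k / k.factorial)) := by
    refine intervalIntegral.norm_integral_le_of_norm_le ht.1 (.of_forall fun s hs => ?_)
      (Continuous.intervalIntegrable (by fun_prop) _ _)
    exact (A s).le_of_opNorm_le_of_le (hK s hs.1.le) (hf s ⟨hs.1.le, hs.2.trans ht.2⟩)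
  refine h1.trans (le_of_eq ?_)
  have h2 : (fun s : ℝ => K * (M * ((K * s) ^ k / k.factorial)))
      = fun s => (K ^ (k + 1) * M / k.factorial) * s ^ k := by
    ext s; rw [mul_pow]; ring
  rw [h2, intervalIntegral.integral_const_mul, integral_pow, Nat.factorial_succ]
  have : (k.factorial : ℝ) ≠ 0 := by positivity
  push_cast
  field_simp
  rw [mul_pow]
  simp
  ring

/-- Inserting the equation into itself k times bounds `d` by M(Kt)^k/k!, which tends to 0. -/
theorem volterra_eq_zero {A : ℝ → E →L[ℝ] E} {d : ℝ → E} {K T : ℝ}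
    (hK : ∀ t, 0 ≤ t → ‖A t‖ ≤ K) (hd : ContinuousOn d (Icc 0 T))
    (h : ∀ t ∈ Icc 0 T, d t = ∫ s in (0 : ℝ)..t, A s (d s)) {t : ℝ} (ht : t ∈ Icc 0 T) :
    d t = 0 := by
  obtain ⟨M, hM⟩ := isCompact_Icc.exists_bound_of_continuousOn hd
  have hb : ∀ k : ℕ, ∀ t ∈ Icc 0 T, ‖d t‖ ≤ M * ((K * t) ^ k / k.factorial) := by
    intro k
    induction k with
    | zero => simpa using hM
    | succ k ih =>
      intro t ht
      rw [h t ht]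
      exact norm_integral_clm_apply_le hK ih ht
  have hlim := (FloorSemiring.tendsto_pow_div_factorial_atTop (K * t)).const_mul M
  rw [mul_zero] at hlim
  exact norm_le_zero_iff.1 (ge_of_tendsto' hlim fun k => hb k t ht)

/-- Terms of the Peano–Baker series. -/
def peanoBaker (A : ℝ → E →L[ℝ] E) (h : ℝ → E) : ℕ → ℝ → E
  | 0 => h
  | k + 1 => fun t => ∫ s in (0 : ℝ)..t, A s (peanoBaker A h k s)

variable {A : ℝ → E →L[ℝ] E} {h : ℝ → E} {K T M : ℝ}

theorem norm_peanoBaker_le (hK : ∀ t, 0 ≤ t → ‖A t‖ ≤ K) (hM : ∀ t ∈ Icc 0 T, ‖h t‖ ≤ M)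
    (k : ℕ) : ∀ t ∈ Icc 0 T, ‖peanoBaker A h k t‖ ≤ M * ((K * t) ^ k / k.factorial) := by
  induction k with
  | zero => simpa [peanoBaker] using hM
  | succ k ih => exact fun t ht => norm_integral_clm_apply_le hK ih ht

theorem continuousOn_peanoBaker (hA : AEStronglyMeasurable A (volume.restrict (Ici 0)))
    (hK : ∀ t, 0 ≤ t → ‖A t‖ ≤ K) (hh : ContinuousOn h (Icc 0 T)) (k : ℕ) :
    ContinuousOn (peanoBaker A h k) (Icc 0 T) := by
  induction k with
  | zero => exact hh
  | succ k ih =>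
    rcases le_total 0 T with hT | hT
    · have := intervalIntegrable_clm_apply hA hK ih (t := T) ⟨hT, le_rfl⟩
      rw [intervalIntegrable_iff_integrableOn_Icc_of_le hT] at this
      have h2 := intervalIntegral.continuousOn_primitive_interval (by rwa [uIcc_of_le hT])
      rwa [uIcc_of_le hT] at h2
    · exact (subsingleton_Icc_of_ge hT).continuousOn _

theorem continuousOn_Ici_of_Icc {F : Type*} [TopologicalSpace F] {f : ℝ → F}
    (hf : ∀ T, 0 ≤ T → ContinuousOn f (Icc 0 T)) : ContinuousOn f (Ici 0) := by
  intro t ht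
  have ht' : (0 : ℝ) ≤ t := ht
  refine (hf (t + 1) (by linarith) t ⟨ht, by linarith⟩).mono_of_mem_nhdsWithin ?_
  rw [← Ici_inter_Iic]
  exact Filter.inter_mem self_mem_nhdsWithin (mem_nhdsWithin_of_mem_nhds (Iic_mem_nhds (by linarith)))

/-- The solution is the sum of the Peano–Baker series. The factorial bounds are uniform on each [0,
T], so the sum is continuous and may be integrated term by term. -/
theorem exists_volterra [CompleteSpace E]
    (hA : AEStronglyMeasurable A (volume.restrict (Ici 0)))
    (hK : ∀ t, 0 ≤ t → ‖A t‖ ≤ K) (hh : ContinuousOn h (Ici 0)) :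
    ∃ x : ℝ → E, ContinuousOn x (Ici 0) ∧
      ∀ t, 0 ≤ t → x t = h t + ∫ s in (0 : ℝ)..t, A s (x s) := by
  have hK0 : 0 ≤ K := (norm_nonneg _).trans (hK 0 le_rfl)
  have hhT : ∀ T, ContinuousOn h (Icc 0 T) := fun T => hh.mono Icc_subset_Ici_self
  have key : ∀ T, 0 ≤ T → ∃ M : ℕ → ℝ, Summable M ∧
      ∀ k, ∀ t ∈ Icc 0 T, ‖peanoBaker A h k t‖ ≤ M k := by
    intro T hT
    obtain ⟨M, hM⟩ := isCompact_Icc.exists_bound_of_continuousOn (hhT T)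
    have hM0 : 0 ≤ M := (norm_nonneg _).trans (hM 0 ⟨le_rfl, hT⟩)
    refine ⟨fun k => M * ((K * T) ^ k / k.factorial),
      (Real.summable_pow_div_factorial _).mul_left M, fun k t ht => ?_⟩
    refine (norm_peanoBaker_le hK hM k t ht).trans ?_
    have h1 : (K * t) ^ k ≤ (K * T) ^ k :=
      pow_le_pow_left₀ (mul_nonneg hK0 ht.1) (mul_le_mul_of_nonneg_left ht.2 hK0) k
    dsimp only
    gcongr
  refine ⟨fun t => ∑' k, peanoBaker A h k t, continuousOn_Ici_of_Icc fun T hT => ?_,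
    fun t ht => ?_⟩
  · obtain ⟨M, hM, hb⟩ := key T hT
    exact continuousOn_tsum (fun k => continuousOn_peanoBaker hA hK (hhT T) k) hM
      fun k t ht => hb k t ht
  · obtain ⟨M, hM, hb⟩ := key t ht
    have hsum : ∀ s ∈ Icc 0 t, Summable fun k => peanoBaker A h k s := fun s hs =>
      .of_norm_bounded hM fun k => hb k s hs
    dsimp only
    -- The zeroth term is `h`; each later term is the integral of `A` applied to its predecessor.
    rw [(hsum t ⟨ht, le_rfl⟩).tsum_eq_zero_add]
    congr 1
    refine HasSum.tsum_eq (intervalIntegral.hasSum_integral_of_dominated_convergence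
      (fun k _ => K * M k) (fun k => ?_) (fun k => .of_forall fun s hs => ?_)
      (.of_forall fun s hs => hM.mul_left K) (by simp) (.of_forall fun s hs => ?_))
    · exact (aestronglyMeasurable_clm_apply hA (continuousOn_peanoBaker hA hK (hhT t) k)).mono_measure
        (Measure.restrict_mono (by rw [uIoc_of_le ht]; exact Ioc_subset_Icc_self) le_rfl)
    · rw [uIoc_of_le ht] at hs
      exact (A s).le_of_opNorm_le_of_le (hK s hs.1.le) (hb k s ⟨hs.1.le, hs.2⟩)
    · rw [uIoc_of_le ht] at hs
      exact (hsum s ⟨hs.1.le, hs.2⟩).hasSum.mapL (A s)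

end Volterra

/-! ### Linear time-varying systems -/

section Linear

variable {n : ℕ}

theorem IsSolution.continuousOn_apply {f : ℝ → (Fin n → ℝ) → (Fin n → ℝ)} {x : ℝ → Fin n → ℝ}
    (hx : IsSolution f x) (i : Fin n) : ContinuousOn (fun t => x t i) (Ici 0) := by
  refine continuousOn_Ici_of_Icc fun T hT => ?_
  have h := (hx i T hT).1
  rw [intervalIntegrable_iff_integrableOn_Icc_of_le hT, ← uIcc_of_le hT] at h
  have h2 := intervalIntegral.continuousOn_primitive_interval h
  rw [uIcc_of_le hT] at h2
  exact (continuousOn_const.add h2).congr fun t ht => (hx i t ht.1).2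

theorem IsSolution.continuousOn {f : ℝ → (Fin n → ℝ) → (Fin n → ℝ)} {x : ℝ → Fin n → ℝ}
    (hx : IsSolution f x) : ContinuousOn x (Ici 0) :=
  continuousOn_pi.2 hx.continuousOn_apply

/-- The weights `m` stand for inductances and capacitances, so the left side is the change of stored
energy. -/
theorem IsSolution.energy {f : ℝ → (Fin n → ℝ) → (Fin n → ℝ)} {x : ℝ → Fin n → ℝ}
    (hx : IsSolution f x) (m : Fin n → ℝ) {T : ℝ} (hT : 0 ≤ T) :
    (∑ i, m i * x T i ^ 2) / 2 - (∑ i, m i * x 0 i ^ 2) / 2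
      = ∫ t in (0 : ℝ)..T, ∑ i, m i * (x t i * f t (x t) i) := by
  have hint : ∀ i, IntervalIntegrable (fun t => m i * (x t i * f t (x t) i)) volume 0 T := by
    intro i
    refine ((hx i T hT).1.continuousOn_mul ?_).const_mul _
    exact (hx.continuousOn_apply i).mono (by rw [uIcc_of_le hT]; exact Icc_subset_Ici_self)
  rw [intervalIntegral.integral_finsetSum fun i _ => hint i, ← sub_div, ← Finset.sum_sub_distrib,
    Finset.sum_div]
  refine Finset.sum_congr rfl fun i _ => ?_
  have h := sq_sub_sq_eq_integral hT (hx i T hT).1 fun t ht => (hx i t ht.1).2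
  rw [intervalIntegral.integral_const_mul] at h ⊢
  rw [← mul_sub, h]
  ring

/-- Multiplication by a matrix, as a continuous linear map. -/
def mulVecCLM (A : Matrix (Fin n) (Fin n) ℝ) : (Fin n → ℝ) →L[ℝ] (Fin n → ℝ) :=
  LinearMap.toContinuousLinearMap (Matrix.toLin' A)

@[simp]
theorem mulVecCLM_apply (A : Matrix (Fin n) (Fin n) ℝ) (x : Fin n → ℝ) :
    mulVecCLM A x = A *ᵥ x := by
  simp [mulVecCLM]

variable {A : ℝ → Matrix (Fin n) (Fin n) ℝ} {K : ℝ}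

theorem aestronglyMeasurable_mulVecCLM
    (hA : ∀ i j, AEMeasurable (fun t => A t i j) (volume.restrict (Ici 0))) :
    AEStronglyMeasurable (fun t => mulVecCLM (A t)) (volume.restrict (Ici 0)) := by
  have h1 : AEStronglyMeasurable (fun t => (fun i j => A t i j : Fin n → Fin n → ℝ))
      (volume.restrict (Ici 0)) :=
    (aemeasurable_pi_lambda _ fun i => aemeasurable_pi_lambda _ fun j => hA i j).aestronglyMeasurable
  -- Linear between finite-dimensional spaces, hence continuous: entrywise measurability passes to
  -- the operator norm.
  let Φ : (Fin n → Fin n → ℝ) →ₗ[ℝ] ((Fin n → ℝ) →L[ℝ] (Fin n → ℝ)) :=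
    (LinearMap.toContinuousLinearMap.toLinearMap).comp
      ((Matrix.toLin' (R := ℝ) (m := Fin n) (n := Fin n)).toLinearMap.comp
        (Matrix.ofLinearEquiv ℝ).toLinearMap)
  exact Φ.continuous_of_finiteDimensional.comp_aestronglyMeasurable h1

theorem norm_mulVecCLM_le {B : Matrix (Fin n) (Fin n) ℝ} (hK0 : 0 ≤ K) (hB : ∀ i j, |B i j| ≤ K) :
    ‖mulVecCLM B‖ ≤ n * K := by
  refine ContinuousLinearMap.opNorm_le_bound _ (by positivity) fun x => ?_
  rw [mulVecCLM_apply, pi_norm_le_iff_of_nonneg (by positivity)]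
  intro i
  calc ‖(B *ᵥ x) i‖ ≤ ∑ j, ‖B i j * x j‖ := by
        rw [Matrix.mulVec_eq_sum, Finset.sum_apply]
        refine (norm_sum_le _ _).trans (le_of_eq (Finset.sum_congr rfl fun j _ => ?_))
        simp
    _ ≤ ∑ _j : Fin n, K * ‖x‖ := by
        refine Finset.sum_le_sum fun j _ => ?_
        rw [norm_mul]
        exact mul_le_mul (hB i j) (norm_le_pi_norm x j) (norm_nonneg _) hK0
    _ = n * K * ‖x‖ := by simp [mul_assoc]

theorem intervalIntegral_apply {f : ℝ → Fin n → ℝ} {a b : ℝ}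
    (hf : IntervalIntegrable f volume a b) (i : Fin n) :
    (∫ s in a..b, f s) i = ∫ s in a..b, f s i :=
  ((ContinuousLinearMap.proj (R := ℝ) (φ := fun _ : Fin n => ℝ) i).intervalIntegral_comp_comm
    hf).symm

/-- The integral of `g` is put into the free term of the Volterra equation, so local integrability
of the input is enough. -/
theorem exists_isSolution_linear {g : ℝ → Fin n → ℝ}
    (hA : ∀ i j, AEMeasurable (fun t => A t i j) (volume.restrict (Ici 0)))
    (hK : ∀ t, 0 ≤ t → ∀ i j, |A t i j| ≤ K)
    (hg : ∀ i t, 0 ≤ t → IntervalIntegrable (fun s => g s i) volume 0 t) (x₀ : Fin n → ℝ) :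
    ∃ x, IsSolution (fun t ξ => A t *ᵥ ξ + g t) x ∧ x 0 = x₀ := by
  -- Without entries the hypothesis on `K` does not give 0 ≤ `K`.
  rcases Nat.eq_zero_or_pos n with rfl | hn
  · exact ⟨fun _ => x₀, fun i => i.elim0, rfl⟩
  have hK0 : 0 ≤ K := (abs_nonneg _).trans (hK 0 le_rfl ⟨0, hn⟩ ⟨0, hn⟩)
  have hh : ContinuousOn (fun t i => x₀ i + ∫ s in (0 : ℝ)..t, g s i) (Ici 0) := by
    refine continuousOn_pi.2 fun i => continuousOn_const.add (continuousOn_Ici_of_Icc fun T hT => ?_)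
    have h := hg i T hT
    rw [intervalIntegrable_iff_integrableOn_Icc_of_le hT, ← uIcc_of_le hT] at h
    have h2 := intervalIntegral.continuousOn_primitive_interval h
    rwa [uIcc_of_le hT] at h2
  have hAm := aestronglyMeasurable_mulVecCLM hA
  have hAK : ∀ t, 0 ≤ t → ‖mulVecCLM (A t)‖ ≤ n * K := fun t ht => norm_mulVecCLM_le hK0 (hK t ht)
  obtain ⟨x, hxc, hx⟩ := exists_volterra hAm hAK hh
  refine ⟨x, fun i t ht => ?_, ?_⟩
  · have hint := intervalIntegrable_clm_apply hAm hAK (hxc.mono Icc_subset_Ici_self)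
      (t := t) (T := t) ⟨ht, le_rfl⟩
    have hi : IntervalIntegrable (fun s => (A s *ᵥ x s) i) volume 0 t := by
      rw [intervalIntegrable_iff] at hint ⊢
      simpa [IntegrableOn] using hint.eval i
    refine ⟨hi.add (hg i t ht), ?_⟩
    have h0 : x 0 = x₀ := by rw [hx 0 le_rfl]; simp
    have hxt := congrFun (hx t ht) i
    rw [Pi.add_apply, intervalIntegral_apply hint] at hxt
    rw [hxt, h0]
    simp only [mulVecCLM_apply, Pi.add_apply]
    rw [intervalIntegral.integral_add hi (hg i t ht)]
    ring
  · rw [hx 0 le_rfl]; simp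

/-- The inputs need to agree only up to T; this is the source of causality. -/
theorem IsSolution.eq_of_linear {g g' : ℝ → Fin n → ℝ} {x x' : ℝ → Fin n → ℝ} {T : ℝ}
    (hA : ∀ i j, AEMeasurable (fun t => A t i j) (volume.restrict (Ici 0)))
    (hK : ∀ t, 0 ≤ t → ∀ i j, |A t i j| ≤ K)
    (hx : IsSolution (fun t ξ => A t *ᵥ ξ + g t) x)
    (hx' : IsSolution (fun t ξ => A t *ᵥ ξ + g' t) x') (h0 : x 0 = x' 0)
    (hgg : ∀ t ∈ Icc 0 T, g t = g' t) : ∀ t ∈ Icc 0 T, x t = x' t := by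
  rcases Nat.eq_zero_or_pos n with rfl | hn
  · exact fun t _ => Subsingleton.elim _ _
  have hK0 : 0 ≤ K := (abs_nonneg _).trans (hK 0 le_rfl ⟨0, hn⟩ ⟨0, hn⟩)
  have hAm := aestronglyMeasurable_mulVecCLM hA
  have hAK : ∀ t, 0 ≤ t → ‖mulVecCLM (A t)‖ ≤ n * K := fun t ht => norm_mulVecCLM_le hK0 (hK t ht)
  have hc : ContinuousOn (fun t => x t - x' t) (Icc 0 T) :=
    (hx.continuousOn.sub hx'.continuousOn).mono Icc_subset_Ici_self
  intro t ht
  refine sub_eq_zero.1 (volterra_eq_zero hAK hc (fun t ht => ?_) ht)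
  have hint := intervalIntegrable_clm_apply hAm hAK hc ht
  ext i
  rw [intervalIntegral_apply hint, Pi.sub_apply, (hx i t ht.1).2, (hx' i t ht.1).2, h0,
    add_sub_add_left_eq_sub, ← intervalIntegral.integral_sub (hx i t ht.1).1 (hx' i t ht.1).1]
  refine intervalIntegral.integral_congr fun s hs => ?_
  rw [uIcc_of_le ht.1] at hs
  simp [hgg s ⟨hs.1, hs.2.trans ht.2⟩, Matrix.mulVec_sub]

end Linear

/-! ### The extended space of square-integrable signals -/

theorem MemL2e.congr {f g : ℝ → ℝ} (hf : MemL2e f) (h : ∀ t, 0 ≤ t → f t = g t) : MemL2e g := by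
  intro T
  refine (memLp_congr_ae ?_).1 (hf T)
  filter_upwards [ae_restrict_mem measurableSet_Icc] with t ht
  exact h t ht.1

theorem MemL2e.add {f g : ℝ → ℝ} (hf : MemL2e f) (hg : MemL2e g) :
    MemL2e fun t => f t + g t := fun T => (hf T).add (hg T)

theorem MemL2e.neg {f : ℝ → ℝ} (hf : MemL2e f) : MemL2e fun t => -f t := fun T => (hf T).neg

theorem MemL2e.bdd_mul {m f : ℝ → ℝ} {C : ℝ} (hf : MemL2e f)
    (hm : AEMeasurable m (volume.restrict (Ici 0))) (hC : ∀ t, 0 ≤ t → |m t| ≤ C) :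
    MemL2e fun t => m t * f t := by
  intro T
  have hm' : AEStronglyMeasurable m (volume.restrict (Icc 0 T)) :=
    (hm.mono_measure (Measure.restrict_mono Icc_subset_Ici_self le_rfl)).aestronglyMeasurable
  refine MemLp.of_le_mul (c := C) (hf T) (hm'.mul (hf T).1) ?_
  filter_upwards [ae_restrict_mem measurableSet_Icc] with t ht
  rw [norm_mul]
  exact mul_le_mul_of_nonneg_right (hC t ht.1) (norm_nonneg _)

theorem memL2e_of_continuousOn {f : ℝ → ℝ} (hf : ContinuousOn f (Ici 0)) : MemL2e f := by
  intro T
  have h : ContinuousOn f (Icc 0 T) := hf.mono Icc_subset_Ici_self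
  obtain ⟨M, hM⟩ := isCompact_Icc.exists_bound_of_continuousOn h
  refine MemLp.of_bound (h.aestronglyMeasurable_of_isCompact isCompact_Icc measurableSet_Icc) M ?_
  filter_upwards [ae_restrict_mem measurableSet_Icc] with t ht
  exact hM t ht

theorem MemL2e.intervalIntegrable {f : ℝ → ℝ} (hf : MemL2e f) {T : ℝ} (hT : 0 ≤ T) :
    IntervalIntegrable f volume 0 T := by
  rw [intervalIntegrable_iff_integrableOn_Icc_of_le hT]
  exact (hf T).integrable (by norm_num)

theorem MemL2e.intervalIntegrable_mul {f g : ℝ → ℝ} (hf : MemL2e f) (hg : MemL2e g) {T : ℝ}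
    (hT : 0 ≤ T) : IntervalIntegrable (fun t => f t * g t) volume 0 T := by
  rw [intervalIntegrable_iff_integrableOn_Icc_of_le hT]
  exact (hf T).integrable_mul (hg T)

theorem MemL2e.intervalIntegrable_sq {f : ℝ → ℝ} (hf : MemL2e f) {T : ℝ} (hT : 0 ≤ T) :
    IntervalIntegrable (fun t => f t ^ 2) volume 0 T := by
  simpa only [sq] using hf.intervalIntegrable_mul hf hT

theorem normT_sq (f : ℝ → ℝ) {T : ℝ} (hT : 0 ≤ T) :
    normT T f ^ 2 = ∫ t in (0 : ℝ)..T, f t ^ 2 :=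
  Real.sq_sqrt (intervalIntegral.integral_nonneg hT fun _ _ => sq_nonneg _)

theorem normT_nonneg (T : ℝ) (f : ℝ → ℝ) : 0 ≤ normT T f := Real.sqrt_nonneg _

theorem normT_congr {f g : ℝ → ℝ} {T : ℝ} (hT : 0 ≤ T) (h : ∀ t, 0 ≤ t → f t = g t) :
    normT T f = normT T g := by
  unfold normT
  congr 1
  refine intervalIntegral.integral_congr fun t ht => ?_
  rw [uIcc_of_le hT] at ht
  simp only [h t ht.1]

theorem normT_const_mul (c : ℝ) (f : ℝ → ℝ) (T : ℝ) :
    normT T (fun t => c * f t) = |c| * normT T f := by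
  simp only [normT, mul_pow, intervalIntegral.integral_const_mul]
  rw [Real.sqrt_mul (sq_nonneg c), Real.sqrt_sq_eq_abs]

/-- Young's inequality for the truncated inner product. -/
theorem innerT_le {f g : ℝ → ℝ} (hf : MemL2e f) (hg : MemL2e g) {δ T : ℝ} (hδ : 0 < δ)
    (hT : 0 ≤ T) : innerT T f g ≤ normT T f ^ 2 / (2 * δ) + δ / 2 * normT T g ^ 2 := by
  rw [normT_sq f hT, normT_sq g hT, div_eq_inv_mul, ← intervalIntegral.integral_const_mul,
    ← intervalIntegral.integral_const_mul, ← intervalIntegral.integral_add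
      ((hf.intervalIntegrable_sq hT).const_mul _) ((hg.intervalIntegrable_sq hT).const_mul _)]
  refine intervalIntegral.integral_mono_on hT (hf.intervalIntegrable_mul hg hT)
    (((hf.intervalIntegrable_sq hT).const_mul _).add ((hg.intervalIntegrable_sq hT).const_mul _))
    fun t _ => ?_
  have h : (2 * δ)⁻¹ * f t ^ 2 + δ / 2 * g t ^ 2 - f t * g t
      = (2 * δ)⁻¹ * (f t - δ * g t) ^ 2 := by
    field_simp; ring
  have : 0 ≤ (2 * δ)⁻¹ * (f t - δ * g t) ^ 2 := by positivity
  linarith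

/-! ### The operators of the two subsystems -/

theorem intervalIntegrable_input {n : ℕ} {u : ℝ → ℝ} (hu : MemL2e u) (b : Fin n → ℝ) (i : Fin n)
    (t : ℝ) (ht : 0 ≤ t) : IntervalIntegrable (fun s => (u s • b) i) volume 0 t := by
  simpa using (hu.intervalIntegrable ht).mul_const (b i)

theorem LinSys.isCausalOperator_op {n : ℕ} (S : LinSys n) {K : ℝ}
    (hA : ∀ i j, AEMeasurable (fun t => S.A t i j) (volume.restrict (Ici 0)))
    (hK : ∀ t, 0 ≤ t → ∀ i j, |S.A t i j| ≤ K) : IsCausalOperator S.op := by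
  refine ⟨fun x₀ u hu => ?_, ?_⟩
  · obtain ⟨x, hx, h0⟩ := exists_isSolution_linear hA hK (intervalIntegrable_input hu S.b) x₀
    refine ⟨fun t => S.c ⬝ᵥ x t, memL2e_of_continuousOn ?_, hu, x, hx, h0, fun _ _ => rfl⟩
    exact continuousOn_finsetSum _ fun i _ => continuousOn_const.mul (hx.continuousOn_apply i)
  · rintro x₀ u u' y y' T - ⟨-, x, hx, h0, hy⟩ ⟨-, x', hx', h0', hy'⟩ huu t ht
    rw [hy t ht.1, hy' t ht.1, hx.eq_of_linear hA hK hx' (h0.trans h0'.symm)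
      (fun s hs => by rw [huu s hs]) t ht]

/-- A linear system whose state matrix depends continuously on a parameter that varies measurably
in a compact set is a causal operator. -/
theorem LinSys.isCausalOperator_op_of_continuous {n : ℕ} {X : Type*} [TopologicalSpace X]
    [MeasurableSpace X] [OpensMeasurableSpace X] {M : X → Matrix (Fin n) (Fin n) ℝ} {k : Set X}
    {u : ℝ → X} (hM : ∀ i j, Continuous fun a => M a i j) (hk : IsCompact k)
    (hu : AEMeasurable u (volume.restrict (Ici 0))) (huk : ∀ t, 0 ≤ t → u t ∈ k)
    (b c : Fin n → ℝ) : IsCausalOperator (LinSys.op ⟨fun t => M (u t), b, c⟩) := by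
  choose K hK using fun i j => hk.exists_bound_of_continuousOn (hM i j).continuousOn
  refine LinSys.isCausalOperator_op _ (K := ∑ i, ∑ j, |K i j|)
    (fun i j => (hM i j).measurable.comp_aemeasurable hu)
    fun t ht i j => (hK i j _ (huk t ht)).trans ?_
  calc K i j ≤ |K i j| := le_abs_self _
    _ ≤ ∑ j, |K i j| :=
        Finset.single_le_sum (f := fun j => |K i j|) (fun _ _ => abs_nonneg _) (Finset.mem_univ j)
    _ ≤ _ := Finset.single_le_sum (f := fun i => ∑ j, |K i j|)
        (fun _ _ => Finset.sum_nonneg fun _ _ => abs_nonneg _) (Finset.mem_univ i)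

theorem IsCausalOperator.prePostMul {X : Type} {H : Op X} (hH : IsCausalOperator H) {m : ℝ → ℝ}
    {C : ℝ} (hm : AEMeasurable m (volume.restrict (Ici 0))) (hC : ∀ t, 0 ≤ t → |m t| ≤ C) :
    IsCausalOperator (prePostMul m H) := by
  refine ⟨fun x₀ u hu => ?_, ?_⟩
  · obtain ⟨z, hz, hHz⟩ := hH.1 x₀ _ (hu.bdd_mul hm hC)
    exact ⟨fun t => m t * z t, hz.bdd_mul hm hC, hu, z, hHz, fun _ _ => rfl⟩
  · rintro x₀ u u' y y' T hT ⟨-, z, hz, hy⟩ ⟨-, z', hz', hy'⟩ huu t ht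
    rw [hy t ht.1, hy' t ht.1, hH.2 x₀ _ _ z z' T hT hz hz' (fun s hs => by simp only [huu s hs])
      t ht]

section Control

variable {um uM : ℝ} {u : ℝ → ℝ}

theorem IsControl.abs_le_one (hum : 0 < um) (huM : uM ≤ 1) (hu : IsControl um uM u) (t : ℝ)
    (ht : 0 ≤ t) : |u t| ≤ 1 := by
  have h := hu.2 t ht
  rw [abs_of_pos (hum.trans_le h.1)]
  exact h.2.trans huM

theorem IsControl.pos (hum : 0 < um) (hu : IsControl um uM u) {t : ℝ} (ht : 0 ≤ t) : 0 < u t :=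
  hum.trans_le (hu.2 t ht).1

end Control

namespace Params

variable (p : Params) {um uM : ℝ} {u : ℝ → ℝ}

theorem continuous_A2_apply (i j : Fin 3) : Continuous fun a => p.A2 a i j := by
  fin_cases i <;> fin_cases j <;> simp [A2] <;> fun_prop

theorem isCausalOperator_sys1 : IsCausalOperator p.sys1.op :=
  LinSys.isCausalOperator_op_of_continuous (M := fun _ : ℝ => p.sys1.A 0) (u := fun _ => 0)
    (fun _ _ => continuous_const) isCompact_singleton aemeasurable_const (fun _ _ => rfl) _ _

theorem isCausalOperator_op1 (hum : 0 < um) (huM : uM ≤ 1) (hu : IsControl um uM u) :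
    IsCausalOperator (p.op1 u) :=
  p.isCausalOperator_sys1.prePostMul hu.1 (hu.abs_le_one hum huM)

theorem isCausalOperator_sys2 (hu : IsControl um uM u) : IsCausalOperator (p.sys2 u).op :=
  LinSys.isCausalOperator_op_of_continuous (M := p.A2) p.continuous_A2_apply isCompact_Icc hu.1 hu.2
    _ _

/-- Stored energy of the first subsystem. -/
def H1 (ξ : Fin 2 → ℝ) : ℝ := (p.L₂ * ξ 0 ^ 2 + p.C₂ * ξ 1 ^ 2) / 2

theorem H1_nonneg (ξ : Fin 2 → ℝ) : 0 ≤ p.H1 ξ := by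
  have := p.L₂_pos; have := p.C₂_pos
  unfold H1; positivity

theorem H2_nonneg (ξ : Fin 3 → ℝ) : 0 ≤ p.H2 ξ := by
  have := p.L₁_pos; have := p.C₁_pos; have := p.Csc_pos
  unfold H2; positivity

/-- The terms ∓ξ₁ξ₂ cancel between inductor and capacitor, so only `R₂` dissipates. -/
theorem sys1_energy {w : ℝ → ℝ} {ξ : ℝ → Fin 2 → ℝ} (hw : MemL2e w)
    (hξ : p.sys1.IsTrajectory w ξ) {T : ℝ} (hT : 0 ≤ T) :
    p.H1 (ξ T) - p.H1 (ξ 0) =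
      -(p.R₂ * normT T (fun t => ξ t 0) ^ 2) + ∫ t in (0 : ℝ)..T, w t * ξ t 0 := by
  have hm : MemL2e fun t => ξ t 0 := memL2e_of_continuousOn (hξ.continuousOn_apply 0)
  have h := hξ.energy ![p.L₂, p.C₂] hT
  have hL := p.L₂_pos.ne'
  have hC := p.C₂_pos.ne'
  have hd : IntervalIntegrable (fun t => -(p.R₂ * ξ t 0 ^ 2)) volume 0 T :=
    ((hm.intervalIntegrable_sq hT).const_mul _).neg
  simp only [Fin.sum_univ_two, sys1, Matrix.cons_val_zero, Matrix.cons_val_one] at h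
  rw [H1, H1, h, normT_sq _ hT, ← intervalIntegral.integral_const_mul,
    ← intervalIntegral.integral_neg, ← intervalIntegral.integral_add
      hd (hw.intervalIntegrable_mul hm hT)]
  refine intervalIntegral.integral_congr fun t _ => ?_
  simp [dotProduct, Fin.sum_univ_two]
  field_simp
  ring

theorem d2_integrable {e : ℝ → ℝ} {ξ : ℝ → Fin 3 → ℝ} (hξ : (p.sys2 u).IsTrajectory e ξ) {T : ℝ}
    (hT : 0 ≤ T) : IntervalIntegrable (fun t => p.d2 (ξ t)) volume 0 T := by
  have hm : ∀ i, MemL2e fun t => ξ t i := fun i => memL2e_of_continuousOn (hξ.continuousOn_apply i)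
  exact ((((hm 0).intervalIntegrable_sq hT).const_mul _).add
      (((hm 1).intervalIntegrable_sq hT).const_mul _)).add
      (((hm 2).intervalIntegrable_sq hT).const_mul _)

/-- The terms ∓u₁x₁x₂ and ±x₁x₅ cancel, which removes the control from the balance. -/
theorem sys2_energy {e : ℝ → ℝ} {ξ : ℝ → Fin 3 → ℝ} (he : MemL2e e)
    (hξ : (p.sys2 u).IsTrajectory e ξ) {T : ℝ} (hT : 0 ≤ T) :
    p.H2 (ξ T) - p.H2 (ξ 0) =
      -(∫ t in (0 : ℝ)..T, p.d2 (ξ t)) + ∫ t in (0 : ℝ)..T, ξ t 1 * e t := by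
  have hm : ∀ i, MemL2e fun t => ξ t i := fun i => memL2e_of_continuousOn (hξ.continuousOn_apply i)
  have h := hξ.energy ![p.L₁, p.C₁, p.Csc] hT
  have hL := p.L₁_pos.ne'
  have hC := p.C₁_pos.ne'
  have hs := p.Csc_pos.ne'
  have hd : IntervalIntegrable (fun t => -p.d2 (ξ t)) volume 0 T := (p.d2_integrable hξ hT).neg
  simp only [Fin.sum_univ_three, sys2, Matrix.cons_val_zero, Matrix.cons_val_one,
    Matrix.cons_val] at h
  rw [H2, H2, h, ← intervalIntegral.integral_neg, ← intervalIntegral.integral_add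
      hd ((hm 1).intervalIntegrable_mul he hT)]
  refine intervalIntegral.integral_congr fun t _ => ?_
  simp [dotProduct, Fin.sum_univ_three, A2, d2]
  field_simp
  ring

theorem sys2_c_dotProduct (ξ : Fin 3 → ℝ) : (p.sys2 u).c ⬝ᵥ ξ = ξ 1 := by
  simp [sys2, dotProduct, Fin.sum_univ_three]

theorem sys1_c_dotProduct (ξ : Fin 2 → ℝ) : p.sys1.c ⬝ᵥ ξ = ξ 0 := by
  simp [sys1, dotProduct, Fin.sum_univ_two]

/-- Each of the three states has its own resistance or conductance, so `d2` is positive definite.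
The inequality on [s, t] is the difference of the balances on [0, t] and [0, s]. -/
theorem strictlyPassive_sys2 : (p.sys2 u).StrictlyPassive := by
  have hR := p.R₁_pos
  have hG := p.G_pos
  have hs := p.Gsc_pos
  refine ⟨p.H2, p.d2, ?_, by simp [H2], p.H2_nonneg, ?_, by simp [d2], fun ξ hξ => ?_, ?_⟩
  · unfold H2; fun_prop
  · unfold d2; fun_prop
  · obtain ⟨i, hi⟩ := Function.ne_iff.1 hξ
    have : 0 < ξ i ^ 2 := by
      have : ξ i ≠ 0 := hi
      positivity
    unfold d2
    fin_cases i <;> simp only [Fin.zero_eta, Fin.mk_one, Fin.reduceFinMk] at this <;> positivity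
  · intro e ξ he hξ s t hs hst
    have ht := hs.trans hst
    have hm : MemL2e fun t => ξ t 1 := memL2e_of_continuousOn (hξ.continuousOn_apply 1)
    have h1 := p.sys2_energy he hξ hs
    have h2 := p.sys2_energy he hξ ht
    have h3 := intervalIntegral.integral_interval_sub_left (p.d2_integrable hξ ht)
      (p.d2_integrable hξ hs)
    have h4 := intervalIntegral.integral_interval_sub_left (hm.intervalIntegrable_mul he ht)
      (hm.intervalIntegrable_mul he hs)
    have h5 : ∫ τ in s..t, e τ * ((p.sys2 u).c ⬝ᵥ ξ τ) = ∫ τ in s..t, ξ τ 1 * e τ := by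
      simp only [sys2_c_dotProduct, mul_comm]
    rw [h5]
    linarith

theorem innerT_op1_ge (hum : 0 < um) (huM : uM ≤ 1) (hu : IsControl um uM u) {x₀ : Fin 2 → ℝ}
    {v y : ℝ → ℝ} (h : p.op1 u x₀ v y) {T : ℝ} (hT : 0 ≤ T) :
    p.R₂ * normT T y ^ 2 - p.H1 x₀ ≤ innerT T v y := by
  obtain ⟨hv, z, ⟨hw, ξ, hξ, rfl, hz⟩, hy⟩ := h
  have hm : MemL2e fun t => ξ t 0 := memL2e_of_continuousOn (hξ.continuousOn_apply 0)
  have hy' : ∀ t, 0 ≤ t → y t = u t * ξ t 0 := fun t ht => by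
    rw [hy t ht, hz t ht, sys1_c_dotProduct]
  have hE := p.sys1_energy hw hξ hT
  have h1 : innerT T v y = ∫ t in (0 : ℝ)..T, u t * v t * ξ t 0 := by
    refine intervalIntegral.integral_congr fun t ht => ?_
    rw [uIcc_of_le hT] at ht
    simp only [hy' t ht.1]; ring
  have h2 : normT T y ^ 2 ≤ normT T (fun t => ξ t 0) ^ 2 := by
    rw [normT_congr hT hy', normT_sq _ hT, normT_sq _ hT]
    refine intervalIntegral.integral_mono_on hT
      ((hm.bdd_mul hu.1 (hu.abs_le_one hum huM)).intervalIntegrable_sq hT)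
      (hm.intervalIntegrable_sq hT) fun t ht => ?_
    rw [mul_pow]
    exact mul_le_of_le_one_left (sq_nonneg _)
      ((sq_le_one_iff_abs_le_one _).2 (hu.abs_le_one hum huM t ht.1))
  have := p.H1_nonneg (ξ T)
  have := mul_le_mul_of_nonneg_left h2 p.R₂_pos.le
  rw [h1]
  linarith

theorem innerT_sys2_ge {x₀ : Fin 3 → ℝ} {e z : ℝ → ℝ} (h : (p.sys2 u).op x₀ e z) {T : ℝ}
    (hT : 0 ≤ T) : p.G * normT T z ^ 2 - p.H2 x₀ ≤ innerT T e z := by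
  obtain ⟨he, ξ, hξ, rfl, hz⟩ := h
  have hm : MemL2e fun t => ξ t 1 := memL2e_of_continuousOn (hξ.continuousOn_apply 1)
  have hz' : ∀ t, 0 ≤ t → z t = ξ t 1 := fun t ht => by rw [hz t ht, sys2_c_dotProduct]
  have hE := p.sys2_energy he hξ hT
  have h1 : innerT T e z = ∫ t in (0 : ℝ)..T, ξ t 1 * e t := by
    refine intervalIntegral.integral_congr fun t ht => ?_
    rw [uIcc_of_le hT] at ht
    simp only [hz' t ht.1]; ring
  have h2 : p.G * normT T z ^ 2 ≤ ∫ t in (0 : ℝ)..T, p.d2 (ξ t) := by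
    rw [normT_congr hT hz', normT_sq _ hT, ← intervalIntegral.integral_const_mul]
    refine intervalIntegral.integral_mono_on hT
      ((hm.intervalIntegrable_sq hT).const_mul _) (p.d2_integrable hξ hT) fun t _ => ?_
    have := mul_nonneg p.R₁_pos.le (sq_nonneg (ξ t 0))
    have := mul_nonneg p.Gsc_pos.le (sq_nonneg (ξ t 2))
    unfold d2
    linarith
  have := p.H2_nonneg (ξ T)
  rw [h1]
  linarith

theorem outputStrictlyPassive_op1 (hum : 0 < um) (huM : uM ≤ 1) (hu : IsControl um uM u) :
    OutputStrictlyPassive p.R₂ (p.op1 u) :=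
  ⟨p.R₂_pos, fun x₀ => ⟨p.H1 x₀, fun _ _ h _ hT => p.innerT_op1_ge hum huM hu h hT⟩⟩

theorem outputStrictlyPassive_sys2 : OutputStrictlyPassive p.G (p.sys2 u).op :=
  ⟨p.G_pos, fun x₀ => ⟨p.H2 x₀, fun _ _ h _ hT => p.innerT_sys2_ge h hT⟩⟩

end Params

/-! ### The feedback interconnection -/

/-- A signal is a solution if each of its components is a component of some solution. -/
theorem IsSolution.of_components {n : ℕ} {g : ℝ → (Fin n → ℝ) → (Fin n → ℝ)} {y : ℝ → Fin n → ℝ}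
    (h : ∀ i, ∃ (m : ℕ) (f : ℝ → (Fin m → ℝ) → (Fin m → ℝ)) (x : ℝ → Fin m → ℝ) (k : Fin m),
      IsSolution f x ∧ (∀ s, 0 ≤ s → x s k = y s i) ∧ ∀ s, 0 ≤ s → f s (x s) k = g s (y s) i) :
    IsSolution g y := by
  intro i t ht
  obtain ⟨m, f, x, k, hx, hxy, hfg⟩ := h i
  have heq : EqOn (fun s => f s (x s) k) (fun s => g s (y s) i) (uIcc 0 t) := fun s hs => by
    rw [uIcc_of_le ht] at hs
    exact hfg s hs.1
  refine ⟨(intervalIntegrable_congr (heq.mono uIoc_subset_uIcc)).1 (hx k t ht).1, ?_⟩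
  rw [← hxy t ht, ← hxy 0 le_rfl, (hx k t ht).2, intervalIntegral.integral_congr heq]

/-- Used to trade the constant forcing by `I_L` for a ramp in the state. -/
theorem IsSolution.add_smul {n : ℕ} {f g : ℝ → (Fin n → ℝ) → (Fin n → ℝ)} {x : ℝ → Fin n → ℝ}
    (hx : IsSolution f x) (d : Fin n → ℝ)
    (h : ∀ t, 0 ≤ t → g t (x t + t • d) = f t (x t) + d) :
    IsSolution g fun t => x t + t • d := by
  intro i t ht
  have heq : EqOn (fun s => f s (x s) i + d i) (fun s => g s (x s + s • d) i) (uIcc 0 t) :=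
    fun s hs => by
      rw [uIcc_of_le ht] at hs
      simp [h s hs.1]
  refine ⟨(intervalIntegrable_congr (heq.mono uIoc_subset_uIcc)).1
    ((hx i t ht).1.add intervalIntegrable_const), ?_⟩
  rw [← intervalIntegral.integral_congr heq, intervalIntegral.integral_add (hx i t ht).1
    intervalIntegrable_const, intervalIntegral.integral_const]
  have := (hx i t ht).2
  simp only [Pi.add_apply, Pi.smul_apply, smul_eq_mul, zero_mul, add_zero, sub_zero, this]
  ring

/-- The full state with given states of the two subsystems. -/
def joinState (x : (Fin 2 → ℝ) × (Fin 3 → ℝ)) : Fin 5 → ℝ :=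
  ![x.2 0, x.2 1, x.1 0, x.1 1, x.2 2]

theorem splitState_joinState (x : (Fin 2 → ℝ) × (Fin 3 → ℝ)) : splitState (joinState x) = x := by
  ext i <;> fin_cases i <;> simp [splitState, joinState]

namespace Params

variable (p : Params) {um uM I_L : ℝ} {u₁ u₂ : ℝ → ℝ}

/-- State matrix of the feedback interconnection for the values `a`, `b` of the controls. -/
def loopMatrix (a b : ℝ) : Matrix (Fin 5) (Fin 5) ℝ :=
  !![-p.R₁ / p.L₁, -a / p.L₁, 0, 0, 1 / p.L₁;
     a / p.C₁, -p.G / p.C₁, -b / p.C₁, 0, 0;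
     0, b / p.L₂, -p.R₂ / p.L₂, -1 / p.L₂, 0;
     0, 0, 1 / p.C₂, 0, 0;
     -1 / p.Csc, 0, 0, 0, -p.Gsc / p.Csc]

/-- The feedback interconnection as a system with input `u₂ r` and output `x₃`. -/
def loop (u₁ u₂ : ℝ → ℝ) : LinSys 5 where
  A := fun t => p.loopMatrix (u₁ t) (u₂ t)
  b := ![0, 0, 1 / p.L₂, 0, 0]
  c := ![0, 0, 1, 0, 0]

theorem loop_c_dotProduct (x : Fin 5 → ℝ) : (p.loop u₁ u₂).c ⬝ᵥ x = x 2 := by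
  simp [loop, dotProduct, Fin.sum_univ_succ]

theorem continuous_loopMatrix_apply (i j : Fin 5) :
    Continuous fun a : ℝ × ℝ => p.loopMatrix a.1 a.2 i j := by
  fin_cases i <;> fin_cases j <;> simp [loopMatrix] <;> fun_prop

theorem isCausalOperator_loop (h₁ : IsControl um uM u₁) (h₂ : IsControl um uM u₂) :
    IsCausalOperator (p.loop u₁ u₂).op :=
  LinSys.isCausalOperator_op_of_continuous (M := fun a : ℝ × ℝ => p.loopMatrix a.1 a.2)
    p.continuous_loopMatrix_apply (isCompact_Icc.prod isCompact_Icc) (h₁.1.prodMk h₂.1)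
    (fun t ht => ⟨h₁.2 t ht, h₂.2 t ht⟩) _ _

/-- Neither subsystem has direct feedthrough, so closing the loop creates no algebraic equation.
Since u₂v = u₂r + u₂x₂, the result is a linear five-state system driven by u₂r. -/
theorem feedbackLoop_iff (hum : 0 < um) (huM : uM ≤ 1) (h₂ : IsControl um uM u₂) {x₀ : Fin 5 → ℝ}
    {r v y z : ℝ → ℝ} :
    FeedbackLoop (p.op1 u₂) (p.sys2 u₁).op (splitState x₀) r v y z ↔
      MemL2e r ∧ ∃ x, (p.loop u₁ u₂).IsTrajectory (fun t => u₂ t * r t) x ∧ x 0 = x₀ ∧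
        ∀ t, 0 ≤ t → v t = r t + x t 1 ∧ y t = u₂ t * x t 2 ∧ z t = x t 1 := by
  have hb := h₂.abs_le_one hum huM
  constructor
  · rintro ⟨hr, hv, ⟨-, z₁, ⟨-, ξ, hξ, hξ0, hz₁⟩, hy⟩, -, η, hη, hη0, hz⟩
    have hz' : ∀ t, 0 ≤ t → z t = η t 1 := fun t ht => by rw [hz t ht, sys2_c_dotProduct]
    have hy' : ∀ t, 0 ≤ t → y t = u₂ t * ξ t 0 := fun t ht => by
      rw [hy t ht, hz₁ t ht, sys1_c_dotProduct]
    refine ⟨hr, fun t => joinState (ξ t, η t), .of_components fun i => ?_, ?_, fun t ht =>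
      ⟨by rw [hv t ht, hz' t ht]; rfl, hy' t ht, hz' t ht⟩⟩
    · fin_cases i
      · refine ⟨_, _, _, 0, hη, fun _ _ => rfl, fun s hs => ?_⟩
        simp [sys2, loop, loopMatrix, A2, joinState, dotProduct, Fin.sum_univ_succ]
        ring
      · refine ⟨_, _, _, 1, hη, fun _ _ => rfl, fun s hs => ?_⟩
        simp [sys2, loop, loopMatrix, A2, joinState, dotProduct, Fin.sum_univ_succ, hy' s hs]
        ring
      · refine ⟨_, _, _, 0, hξ, fun _ _ => rfl, fun s hs => ?_⟩
        simp [sys1, loop, loopMatrix, joinState, dotProduct, Fin.sum_univ_succ, hv s hs,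
          hz' s hs]
        ring
      · refine ⟨_, _, _, 1, hξ, fun _ _ => rfl, fun s hs => ?_⟩
        simp [sys1, loop, loopMatrix, joinState, dotProduct, Fin.sum_univ_succ]
        ring
      · refine ⟨_, _, _, 2, hη, fun _ _ => rfl, fun s hs => ?_⟩
        simp [sys2, loop, loopMatrix, A2, joinState, dotProduct, Fin.sum_univ_succ]
        ring
    · simp only [hξ0, hη0]
      ext i
      fin_cases i <;> simp [splitState, joinState]
  · rintro ⟨hr, x, hx, rfl, h⟩
    have hm : ∀ i, MemL2e fun t => x t i := fun i => memL2e_of_continuousOn (hx.continuousOn_apply i)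
    have hv : MemL2e v := (hr.add (hm 1)).congr fun t ht => (h t ht).1.symm
    have hy : MemL2e y := ((hm 2).bdd_mul h₂.1 hb).congr fun t ht => (h t ht).2.1.symm
    refine ⟨hr, fun t ht => by rw [(h t ht).1, (h t ht).2.2], ⟨hv, fun t => x t 2,
      ⟨hv.bdd_mul h₂.1 hb, fun t => (splitState (x t)).1, .of_components fun i => ?_, rfl, fun t ht => ?_⟩,
      fun t ht => (h t ht).2.1⟩, hy.neg, fun t => (splitState (x t)).2,
      .of_components fun i => ?_, rfl,
      fun t ht => ?_⟩
    · fin_cases i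
      · refine ⟨_, _, _, 2, hx, fun _ _ => rfl, fun s hs => ?_⟩
        simp [sys1, loop, loopMatrix, splitState, dotProduct, Fin.sum_univ_succ, h s hs]
        ring
      · refine ⟨_, _, _, 3, hx, fun _ _ => rfl, fun s hs => ?_⟩
        simp [sys1, loop, loopMatrix, splitState, dotProduct, Fin.sum_univ_succ]
        ring
    · rw [sys1_c_dotProduct]; rfl
    · fin_cases i
      · refine ⟨_, _, _, 0, hx, fun _ _ => rfl, fun s hs => ?_⟩
        simp [sys2, A2, loop, loopMatrix, splitState, dotProduct, Fin.sum_univ_succ]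
        ring
      · refine ⟨_, _, _, 1, hx, fun _ _ => rfl, fun s hs => ?_⟩
        simp [sys2, A2, loop, loopMatrix, splitState, dotProduct, Fin.sum_univ_succ, h s hs]
        ring
      · refine ⟨_, _, _, 4, hx, fun _ _ => rfl, fun s hs => ?_⟩
        simp [sys2, A2, loop, loopMatrix, splitState, dotProduct, Fin.sum_univ_succ]
        ring
    · rw [sys2_c_dotProduct, (h t ht).2.2]; rfl

theorem memL2e_extInput (hum : 0 < um) (h₂ : IsControl um uM u₂) :
    MemL2e (p.extInput I_L u₂) := by
  have h : MemL2e fun t => I_L / p.C₂ * t := memL2e_of_continuousOn (by fun_prop)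
  refine (h.bdd_mul h₂.1.inv (C := um⁻¹) fun t ht => ?_).congr fun t _ => ?_
  · rw [Pi.inv_apply, abs_of_pos (inv_pos.2 (h₂.pos hum ht))]
    exact inv_anti₀ hum (h₂.2 t ht).1
  · rw [extInput, Pi.inv_apply]; ring

/-- The constant current is absorbed by a linear drift of the state `x₄`. -/
theorem feedbackLoop_extInput_iff (hum : 0 < um) (huM : uM ≤ 1) (h₂ : IsControl um uM u₂)
    {x₀ : Fin 5 → ℝ} {v y z : ℝ → ℝ} :
    FeedbackLoop (p.op1 u₂) (p.sys2 u₁).op (splitState x₀) (p.extInput I_L u₂) v y z ↔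
      ∃ x : ℝ → Fin 5 → ℝ, IsSolution (p.field I_L u₁ u₂) x ∧ x 0 = x₀ ∧
        ∀ t, 0 ≤ t → v t = p.extInput I_L u₂ t + x t 1 ∧ y t = u₂ t * x t 2 ∧ z t = x t 1 := by
  rw [p.feedbackLoop_iff hum huM h₂]
  have hr : ∀ t, 0 ≤ t → u₂ t * p.extInput I_L u₂ t = I_L / p.C₂ * t := fun t ht => by
    have := (h₂.pos hum ht).ne'
    rw [extInput]; field_simp
  have hL₁ := p.L₁_pos.ne'
  have hL₂ := p.L₂_pos.ne'
  have hC₁ := p.C₁_pos.ne'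
  have hC₂ := p.C₂_pos.ne'
  have hCs := p.Csc_pos.ne'
  constructor
  · rintro ⟨-, x, hx, h0, h⟩
    -- The loop has C₂x₄' = x₃; subtracting the ramp I_L t/C₂ restores -I_L there, and the ramp
    -- equals u₂r in the equation of `x₃`.
    refine ⟨fun t => x t + t • ![0, 0, 0, -(I_L / p.C₂), 0], hx.add_smul _ fun t ht => ?_,
      by simpa using h0, fun t ht => by simpa using h t ht⟩
    ext i
    fin_cases i <;> simp [field, loop, loopMatrix, vecHead, vecTail, hr t ht]
      <;> field_simp <;> ring
  · rintro ⟨x, hx, h0, h⟩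
    refine ⟨p.memL2e_extInput hum h₂, fun t => x t + t • ![0, 0, 0, I_L / p.C₂, 0],
      hx.add_smul _ fun t ht => ?_, by simpa using h0, fun t ht => by simpa using h t ht⟩
    ext i
    fin_cases i <;> simp [field, loop, loopMatrix, vecHead, vecTail, hr t ht]
      <;> field_simp <;> ring

theorem closedLoop_iff (hum : 0 < um) (huM : uM ≤ 1) (h₂ : IsControl um uM u₂)
    {x₀ : (Fin 2 → ℝ) × (Fin 3 → ℝ)} {r y : ℝ → ℝ} :
    closedLoop (p.op1 u₂) (p.sys2 u₁).op x₀ r y ↔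
      prePostMul u₂ (p.loop u₁ u₂).op (joinState x₀) r y := by
  have hiff := fun v z => p.feedbackLoop_iff (u₁ := u₁) (x₀ := joinState x₀) (r := r) (v := v)
    (y := y) (z := z) hum huM h₂
  simp only [splitState_joinState] at hiff
  simp only [closedLoop, hiff]
  constructor
  · rintro ⟨v, z, hr, x, hx, h0, h⟩
    exact ⟨hr, fun t => x t 2, ⟨hr.bdd_mul h₂.1 (h₂.abs_le_one hum huM), x, hx, h0,
      fun t _ => (p.loop_c_dotProduct _).symm⟩, fun t ht => (h t ht).2.1⟩
  · rintro ⟨hr, z, ⟨-, x, hx, h0, hz⟩, hy⟩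
    exact ⟨fun t => r t + x t 1, fun t => x t 1, hr, x, hx, h0, fun t ht =>
      ⟨rfl, by rw [hy t ht, hz t ht, loop_c_dotProduct], rfl⟩⟩

/-! ### Well-posedness and finite gain of the closed loop -/

theorem isCausalOperator_closedLoop (hum : 0 < um) (huM : uM ≤ 1) (h₁ : IsControl um uM u₁)
    (h₂ : IsControl um uM u₂) : IsCausalOperator (closedLoop (p.op1 u₂) (p.sys2 u₁).op) := by
  have h := (p.isCausalOperator_loop h₁ h₂).prePostMul h₂.1 (h₂.abs_le_one hum huM)
  refine ⟨fun x₀ u hu => ?_, fun x₀ u u' y y' T hT hy hy' => ?_⟩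
  · simpa only [p.closedLoop_iff hum huM h₂] using h.1 (joinState x₀) u hu
  · exact h.2 _ u u' y y' T hT ((p.closedLoop_iff hum huM h₂).1 hy)
      ((p.closedLoop_iff hum huM h₂).1 hy')

/-- Bias of the closed loop: it depends on the stored energy of the initial state. -/
def bias (x₀ : (Fin 2 → ℝ) × (Fin 3 → ℝ)) : ℝ :=
  √(2 * (p.H1 x₀.1 + p.H2 x₀.2) / p.R₂) + 1

/-- The summand 1 in `bias` serves only this: the root vanishes at the zero state. -/
theorem bias_pos (x₀ : (Fin 2 → ℝ) × (Fin 3 → ℝ)) : 0 < p.bias x₀ := by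
  unfold bias; positivity

theorem normT_le_of_feedbackLoop (hum : 0 < um) (huM : uM ≤ 1) (h₂ : IsControl um uM u₂)
    {x₀ : (Fin 2 → ℝ) × (Fin 3 → ℝ)} {r v y z : ℝ → ℝ}
    (h : FeedbackLoop (p.op1 u₂) (p.sys2 u₁).op x₀ r v y z) {T : ℝ} (hT : 0 ≤ T) :
    normT T y ≤ 1 / p.R₂ * normT T r + p.bias x₀ := by
  obtain ⟨hr, hv, ho₁, ho₂⟩ := h
  have hR := p.R₂_pos
  -- The graphs record square integrability of inputs only; `y` is read off the input `-y`, and `z`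
  -- off v - r.
  have hy : MemL2e y := ho₂.1.neg.congr fun t _ => neg_neg _
  have hz : MemL2e z := (ho₁.1.add hr.neg).congr fun t ht => by rw [hv t ht]; ring
  have e1 := p.innerT_op1_ge hum huM h₂ ho₁ hT
  have e2 := p.innerT_sys2_ge ho₂ hT
  have e3 : innerT T v y + innerT T (fun t => -y t) z = innerT T r y := by
    have hvy := ho₁.1.intervalIntegrable_mul hy hT
    have hyz := hy.neg.intervalIntegrable_mul hz hT
    rw [innerT, innerT, ← intervalIntegral.integral_add hvy hyz]
    refine intervalIntegral.integral_congr fun t ht => ?_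
    rw [uIcc_of_le hT] at ht
    simp only [hv t ht.1]; ring
  -- With weight `R₂`, Young's inequality absorbs half of R₂‖y‖² and leaves ‖r‖²/(2R₂), whence the
  -- gain 1/R₂.
  have e4 := innerT_le hr hy hR hT
  have e5 : 0 ≤ p.G * normT T z ^ 2 := mul_nonneg p.G_pos.le (sq_nonneg _)
  set b := p.H1 x₀.1 + p.H2 x₀.2 with hb
  have hb0 : 0 ≤ 2 * b / p.R₂ := by
    have := p.H1_nonneg x₀.1
    have := p.H2_nonneg x₀.2
    positivity
  have e6 : normT T y ^ 2 ≤ (1 / p.R₂ * normT T r) ^ 2 + 2 * b / p.R₂ := by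
    have e7 : p.R₂ / 2 * normT T y ^ 2 ≤ normT T r ^ 2 / (2 * p.R₂) + b := by linarith
    have e8 := mul_le_mul_of_nonneg_left e7 (by positivity : 0 ≤ 2 / p.R₂)
    calc normT T y ^ 2 = 2 / p.R₂ * (p.R₂ / 2 * normT T y ^ 2) := by field_simp
      _ ≤ _ := e8
      _ = _ := by field_simp
  have hr0 : 0 ≤ 1 / p.R₂ * normT T r := mul_nonneg (by positivity) (normT_nonneg _ _)
  have hs0 := Real.sqrt_nonneg (2 * b / p.R₂)
  have e9 : normT T y ≤ 1 / p.R₂ * normT T r + √(2 * b / p.R₂) := by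
    refine le_of_sq_le_sq ?_ (by positivity)
    have := Real.sq_sqrt hb0
    have := mul_nonneg hr0 hs0
    nlinarith
  rw [bias, ← hb]
  linarith

theorem finiteGainStable_closedLoop (hum : 0 < um) (huM : uM ≤ 1) (h₂ : IsControl um uM u₂) :
    FiniteGainStable (1 / p.R₂) p.bias (closedLoop (p.op1 u₂) (p.sys2 u₁).op) := by
  rintro x₀ r y ⟨v, z, h⟩ T hT
  exact p.normT_le_of_feedbackLoop hum huM h₂ h hT

/-- The extra 1 in the gain keeps it positive when `I_L` = 0. -/
theorem normT_output_le (hum : 0 < um) (huM : uM ≤ 1) (h₂ : IsControl um uM u₂)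
    {x : ℝ → Fin 5 → ℝ} (hx : IsSolution (p.field I_L u₁ u₂) x) {T : ℝ} (hT : 0 ≤ T) :
    normT T (fun t => u₂ t * x t 2) ≤
      (|I_L / p.C₂| / p.R₂ + 1) * normT T (fun t => t / u₂ t) + p.bias (splitState (x 0)) := by
  have h := p.normT_le_of_feedbackLoop hum huM h₂ ((p.feedbackLoop_extInput_iff hum huM h₂).2
    ⟨x, hx, rfl, fun t _ => ⟨rfl, rfl, rfl⟩⟩) hT
  refine h.trans ?_
  have e : normT T (p.extInput I_L u₂) = |I_L / p.C₂| * normT T (fun t => t / u₂ t) :=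
    normT_const_mul _ _ _
  have := normT_nonneg T fun t => t / u₂ t
  have e' : (|I_L / p.C₂| / p.R₂ + 1) * normT T (fun t => t / u₂ t) =
      1 / p.R₂ * (|I_L / p.C₂| * normT T fun t => t / u₂ t) + normT T fun t => t / u₂ t := by ring
  rw [e, e']
  linarith

end Params

/-! ### Transfer functions -/

/-- Exhibiting the state response `x` avoids computing the inverse matrix. -/
theorem transferFunction_eq_of_mulVec_eq {n : ℕ} {A : Matrix (Fin n) (Fin n) ℝ} {b c : Fin n → ℝ}
    {s : ℂ} {x : Fin n → ℂ}
    (hdet : (s • (1 : Matrix (Fin n) (Fin n) ℂ) - A.map (fun a => (a : ℂ))).det ≠ 0)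
    (hx : (s • (1 : Matrix (Fin n) (Fin n) ℂ) - A.map (fun a => (a : ℂ))) *ᵥ x =
      fun i => (b i : ℂ)) :
    transferFunction A b c s = (fun i => (c i : ℂ)) ⬝ᵥ x := by
  rw [transferFunction, ← hx, Matrix.mulVec_mulVec, Matrix.nonsing_inv_mul _ hdet.isUnit,
    Matrix.one_mulVec]

theorem re_inv_nonneg {w : ℂ} (hw : 0 ≤ w.re) : 0 ≤ (w⁻¹).re := by
  rw [Complex.inv_re]
  exact div_nonneg hw (Complex.normSq_nonneg w)

theorem ne_zero_of_re_pos {w : ℂ} (hw : 0 < w.re) : w ≠ 0 := fun h => by simp [h] at hw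

theorem re_inv_pos {w : ℂ} (hw : 0 < w.re) : 0 < (w⁻¹).re := by
  rw [Complex.inv_re]
  exact div_pos hw (Complex.normSq_pos.2 (ne_zero_of_re_pos hw))

namespace Params

variable (p : Params)

theorem tf1_den_eq {s : ℂ} (hs : s ≠ 0) :
    (p.L₂ : ℂ) * s ^ 2 + p.R₂ * s + 1 / p.C₂ = s * (p.L₂ * s + p.R₂ + (p.C₂ * s)⁻¹) := by
  have hC : (p.C₂ : ℂ) ≠ 0 := Complex.ofReal_ne_zero.2 p.C₂_pos.ne'
  field_simp

/-- The impedance of a series RLC branch: the resistance alone makes the real part positive. At s =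
0 the inverse is 0 by convention, so no exception is needed. -/
theorem re_impedance1_pos {s : ℂ} (hs : 0 ≤ s.re) :
    0 < ((p.L₂ : ℂ) * s + p.R₂ + (p.C₂ * s)⁻¹).re := by
  have h1 : 0 ≤ ((p.C₂ : ℂ) * s).re := by
    rw [Complex.re_ofReal_mul]; exact mul_nonneg p.C₂_pos.le hs
  have h2 := re_inv_nonneg h1
  have h3 := mul_nonneg p.L₂_pos.le hs
  have h4 := p.R₂_pos
  rw [Complex.add_re, Complex.add_re, Complex.re_ofReal_mul, Complex.ofReal_re]
  linarith

theorem tf1_den_ne_zero {s : ℂ} (hs : 0 ≤ s.re) :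
    (p.L₂ : ℂ) * s ^ 2 + p.R₂ * s + 1 / p.C₂ ≠ 0 := by
  by_cases h : s = 0
  · simp [h, p.C₂_pos.ne']
  · rw [p.tf1_den_eq h]
    exact mul_ne_zero h (ne_zero_of_re_pos (p.re_impedance1_pos hs))

theorem re_tf1_pos {s : ℂ} (hs : 0 ≤ s.re) (h : s ≠ 0) : 0 < (p.tf1 s).re := by
  rw [tf1, p.tf1_den_eq h, div_mul_eq_div_div, div_self h, one_div]
  exact re_inv_pos (p.re_impedance1_pos hs)

theorem positiveReal_tf1 : PositiveReal p.tf1 := by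
  refine ⟨?_, fun a _ => ?_, fun s hs => (p.re_tf1_pos hs.le fun h => by simp [h] at hs).le⟩
  · exact DifferentiableOn.div (by fun_prop) (by fun_prop)
      fun s hs => p.tf1_den_ne_zero (le_of_lt hs)
  · have : p.tf1 a = ((a / (p.L₂ * a ^ 2 + p.R₂ * a + 1 / p.C₂) : ℝ) : ℂ) := by
      rw [tf1]; push_cast; rfl
    rw [this, Complex.ofReal_im]

theorem transferFunction_sys1 {s : ℂ} (hs : (p.L₂ : ℂ) * s ^ 2 + p.R₂ * s + 1 / p.C₂ ≠ 0) :
    transferFunction (p.sys1.A 0) p.sys1.b p.sys1.c s = p.tf1 s := by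
  have hL : (p.L₂ : ℂ) ≠ 0 := Complex.ofReal_ne_zero.2 p.L₂_pos.ne'
  have hC : (p.C₂ : ℂ) ≠ 0 := Complex.ofReal_ne_zero.2 p.C₂_pos.ne'
  set D := (p.L₂ : ℂ) * s ^ 2 + p.R₂ * s + 1 / p.C₂ with hD
  rw [transferFunction_eq_of_mulVec_eq (x := ![s / D, 1 / (p.C₂ * D)])]
  · simp [sys1, tf1, dotProduct, Fin.sum_univ_two, hD]
  · have : (s • (1 : Matrix (Fin 2) (Fin 2) ℂ) - (p.sys1.A 0).map (fun a => (a : ℂ))).det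
        = D / p.L₂ := by
      simp [Matrix.det_fin_two, sys1, hD]
      field_simp
      ring
    rw [this]
    exact div_ne_zero hs hL
  · ext i
    fin_cases i
    · simp [mulVec, dotProduct, Fin.sum_univ_two, sys1]
      field_simp
      rw [hD]
      field_simp
      ring
    · simp [mulVec, dotProduct, Fin.sum_univ_two, sys1]
      field_simp
      ring

/-- Admittance of the capacitor branch of the inductor loop. -/
def impedanceSc (z : ℂ) : ℂ := p.Csc * z + p.Gsc

/-- Impedance of the inductor branch. -/
def impedanceL (z : ℂ) : ℂ := p.L₁ * z + p.R₁ + (p.impedanceSc z)⁻¹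

/-- Admittance of the second subsystem at the constant control `a`. -/
def admittance (a : ℝ) (z : ℂ) : ℂ := p.C₁ * z + p.G + a ^ 2 * (p.impedanceL z)⁻¹

/-- Eliminating `x₅` and then `x₁` yields a continued fraction; the determinant is the product of
its three levels, up to L₁C₁Csc. -/
theorem transferFunction_A2 (a : ℝ) {z : ℂ} (h₃ : p.impedanceSc z ≠ 0) (h₁ : p.impedanceL z ≠ 0)
    (h₂ : p.admittance a z ≠ 0) :
    transferFunction (p.A2 a) (p.sys2 fun _ => a).b (p.sys2 fun _ => a).c z
      = (p.admittance a z)⁻¹ := by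
  have hL : (p.L₁ : ℂ) ≠ 0 := Complex.ofReal_ne_zero.2 p.L₁_pos.ne'
  have hC : (p.C₁ : ℂ) ≠ 0 := Complex.ofReal_ne_zero.2 p.C₁_pos.ne'
  have hS : (p.Csc : ℂ) ≠ 0 := Complex.ofReal_ne_zero.2 p.Csc_pos.ne'
  have e₁ : (p.L₁ : ℂ) * z + p.R₁ = p.impedanceL z - (p.impedanceSc z)⁻¹ := by rw [impedanceL]; ring
  have e₂ : (p.C₁ : ℂ) * z + p.G = p.admittance a z - a ^ 2 * (p.impedanceL z)⁻¹ := by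
    rw [admittance]; ring
  set w₃ := p.impedanceSc z with hw₃
  set w₁ := p.impedanceL z with hw₁
  set w₂ := p.admittance a z with hw₂
  have m₀ : z + p.R₁ / p.L₁ = (w₁ - w₃⁻¹) / p.L₁ := by rw [← e₁]; field_simp
  have m₁ : z + p.G / p.C₁ = (w₂ - a ^ 2 * w₁⁻¹) / p.C₁ := by rw [← e₂]; field_simp
  have m₂ : z + p.Gsc / p.Csc = w₃ / p.Csc := by rw [hw₃, impedanceSc]; field_simp
  have hM : z • (1 : Matrix (Fin 3) (Fin 3) ℂ) - (p.A2 a).map (fun a => (a : ℂ)) =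
      !![(w₁ - w₃⁻¹) / p.L₁, a / p.L₁, -1 / p.L₁;
         -a / p.C₁, (w₂ - a ^ 2 * w₁⁻¹) / p.C₁, 0;
         1 / p.Csc, 0, w₃ / p.Csc] := by
    rw [← m₀, ← m₁, ← m₂]
    ext i j
    fin_cases i <;> fin_cases j <;> simp [A2] <;> ring
  -- Back substitution from x₂ = 1/w₂: x₁ = -a x₂/w₁ and x₅ = -x₁/w₃.
  rw [transferFunction_eq_of_mulVec_eq (x := ![-a / (w₁ * w₂), w₂⁻¹, a / (w₁ * w₂ * w₃)])]
  · simp [sys2, dotProduct, Fin.sum_univ_three]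
  · have : (z • (1 : Matrix (Fin 3) (Fin 3) ℂ) - (p.A2 a).map (fun a => (a : ℂ))).det
        = w₁ * w₂ * w₃ / (p.L₁ * p.C₁ * p.Csc) := by
      rw [hM, Matrix.det_fin_three]
      simp
      field_simp
      ring
    rw [this]
    exact div_ne_zero (mul_ne_zero (mul_ne_zero h₁ h₂) h₃) (mul_ne_zero (mul_ne_zero hL hC) hS)
  · rw [hM]
    ext i
    fin_cases i <;> simp [mulVec, dotProduct, Fin.sum_univ_three, sys2] <;> field_simp <;> ring

/-- Positive real part climbs the ladder `impedanceSc`, `impedanceL`, `admittance`, since inversion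
and addition preserve it. The losses at each level leave room for the shift. -/
theorem strictlyPositiveReal_A2 (a : ℝ) : StrictlyPositiveReal
    (transferFunction (p.A2 a) (p.sys2 fun _ => a).b (p.sys2 fun _ => a).c) := by
  have hL := p.L₁_pos
  have hC := p.C₁_pos
  have hS := p.Csc_pos
  have hR := p.R₁_pos
  have hG := p.G_pos
  have hg := p.Gsc_pos
  obtain ⟨ε, hε, hεL, hεC, hεS⟩ : ∃ ε : ℝ, 0 < ε ∧ p.L₁ * ε ≤ p.R₁ ∧ p.C₁ * ε ≤ p.G ∧
      p.Csc * ε ≤ p.Gsc := by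
    -- The smallest of the three decay rates; equality is harmless because Re s > 0 is strict.
    refine ⟨min (p.R₁ / p.L₁) (min (p.G / p.C₁) (p.Gsc / p.Csc)), by positivity, ?_, ?_, ?_⟩
    · rw [mul_comm, ← le_div_iff₀ hL]; exact min_le_left _ _
    · rw [mul_comm, ← le_div_iff₀ hC]; exact (min_le_right _ _).trans (min_le_left _ _)
    · rw [mul_comm, ← le_div_iff₀ hS]; exact (min_le_right _ _).trans (min_le_right _ _)
  have aux : ∀ {l r : ℝ} {s : ℂ}, 0 < l → l * ε ≤ r → 0 < s.re →
      0 < ((l : ℂ) * (s - ε) + r).re := fun {l r s} hl hr hs => by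
    rw [Complex.add_re, Complex.re_ofReal_mul, Complex.sub_re, Complex.ofReal_re, Complex.ofReal_re]
    have := mul_pos hl hs
    linarith
  have h₃ : ∀ s : ℂ, 0 < s.re → 0 < (p.impedanceSc (s - ε)).re := fun s hs => aux hS hεS hs
  have h₁ : ∀ s : ℂ, 0 < s.re → 0 < (p.impedanceL (s - ε)).re := fun s hs => by
    rw [impedanceL, Complex.add_re]
    exact add_pos (aux hL hεL hs) (re_inv_pos (h₃ s hs))
  have h₂ : ∀ s : ℂ, 0 < s.re → 0 < (p.admittance a (s - ε)).re := fun s hs => by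
    rw [admittance, Complex.add_re, ← Complex.ofReal_pow, Complex.re_ofReal_mul]
    exact add_pos_of_pos_of_nonneg (aux hC hεC hs)
      (mul_nonneg (sq_nonneg a) (re_inv_pos (h₁ s hs)).le)
  have heq : ∀ s : ℂ, 0 < s.re →
      transferFunction (p.A2 a) (p.sys2 fun _ => a).b (p.sys2 fun _ => a).c (s - ε)
        = (p.admittance a (s - ε))⁻¹ := fun s hs =>
    p.transferFunction_A2 a (ne_zero_of_re_pos (h₃ s hs)) (ne_zero_of_re_pos (h₁ s hs))
      (ne_zero_of_re_pos (h₂ s hs))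
  refine ⟨ε, hε, ?_, fun t ht => ?_, fun s hs => ?_⟩
  · refine DifferentiableOn.congr (f := fun s => (p.admittance a (s - ε))⁻¹) ?_ heq
    have d₃ : DifferentiableOn ℂ (fun s => p.impedanceSc (s - ε)) {s | 0 < s.re} := by
      unfold impedanceSc; fun_prop
    have d₁ : DifferentiableOn ℂ (fun s => p.impedanceL (s - ε)) {s | 0 < s.re} :=
      DifferentiableOn.add (by fun_prop) (d₃.inv fun s hs => ne_zero_of_re_pos (h₃ s hs))
    have d₂ : DifferentiableOn ℂ (fun s => p.admittance a (s - ε)) {s | 0 < s.re} :=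
      DifferentiableOn.add (by fun_prop)
        ((d₁.inv fun s hs => ne_zero_of_re_pos (h₁ s hs)).const_mul _)
    exact d₂.inv fun s hs => ne_zero_of_re_pos (h₂ s hs)
  · have hreal : (p.admittance a (t - ε))⁻¹ = (((p.C₁ * (t - ε) + p.G + a ^ 2 *
        (p.L₁ * (t - ε) + p.R₁ + (p.Csc * (t - ε) + p.Gsc)⁻¹)⁻¹)⁻¹ : ℝ) : ℂ) := by
      rw [admittance, impedanceL, impedanceSc]; push_cast; rfl
    simp only
    rw [heq t (by simpa using ht), hreal, Complex.ofReal_im]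
  · simp only
    rw [heq s hs]
    exact (re_inv_pos (h₂ s hs)).le

end Params

end Converter

end

theorem lemma1 (p : Converter.Params) (I_L um uM : ℝ)
    (hum : 0 < um) (humM : um < uM) (huM : uM ≤ 1) :
    -- the LTI block of the forward path has the stated transfer function, which is stable and
    -- positive real, with positive real part on the closed right half-plane except at the origin
    (∀ s : ℂ, (p.L₂ : ℂ) * s ^ 2 + p.R₂ * s + 1 / p.C₂ ≠ 0 →
      Converter.transferFunction (p.sys1.A 0) p.sys1.b p.sys1.c s = p.tf1 s) ∧
    (∀ s : ℂ, 0 ≤ s.re → (p.L₂ : ℂ) * s ^ 2 + p.R₂ * s + 1 / p.C₂ ≠ 0) ∧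
    Converter.PositiveReal p.tf1 ∧
    (∀ s : ℂ, 0 ≤ s.re → s ≠ 0 → 0 < (p.tf1 s).re) ∧
    -- for constant controls the second operator is an SPR transfer function
    (∀ a ∈ Set.Icc um uM, Converter.StrictlyPositiveReal
      (Converter.transferFunction (p.A2 a) (p.sys2 fun _ => a).b (p.sys2 fun _ => a).c)) ∧
    -- constants that do not depend on the controls
    ∃ (δ₁ δ₂ γ₀ γ : ℝ) (β : (Fin 2 → ℝ) × (Fin 3 → ℝ) → ℝ),
      0 < γ₀ ∧ 0 < γ ∧ (∀ x₀, 0 < β x₀) ∧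
      ∀ u₁ u₂ : ℝ → ℝ, Converter.IsControl um uM u₁ → Converter.IsControl um uM u₂ →
        -- the operator `v ↦ y` is well defined and output strictly passive
        Converter.IsCausalOperator (p.op1 u₂) ∧
        Converter.OutputStrictlyPassive δ₁ (p.op1 u₂) ∧
        -- the operator `-y ↦ x₂` is well defined, satisfies the energy balance and is
        -- strictly passive and output strictly passive
        Converter.IsCausalOperator (p.sys2 u₁).op ∧
        (∀ (e : ℝ → ℝ) (ξ : ℝ → Fin 3 → ℝ), Converter.MemL2e e →
          (p.sys2 u₁).IsTrajectory e ξ → ∀ T : ℝ, 0 ≤ T →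
          p.H2 (ξ T) - p.H2 (ξ 0) =
            -(∫ t in (0 : ℝ)..T, p.d2 (ξ t)) + ∫ t in (0 : ℝ)..T, ξ t 1 * e t) ∧
        (p.sys2 u₁).StrictlyPassive ∧
        Converter.OutputStrictlyPassive δ₂ (p.sys2 u₁).op ∧
        -- the system is the feedback interconnection of the two operators
        (∀ (x₀ : Fin 5 → ℝ) (v y z : ℝ → ℝ),
          Converter.FeedbackLoop (p.op1 u₂) (p.sys2 u₁).op (Converter.splitState x₀)
            (p.extInput I_L u₂) v y z ↔
          ∃ x : ℝ → Fin 5 → ℝ, Converter.IsSolution (p.field I_L u₁ u₂) x ∧ x 0 = x₀ ∧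
            ∀ t, 0 ≤ t → v t = p.extInput I_L u₂ t + x t 1 ∧
              y t = u₂ t * x t 2 ∧ z t = x t 1) ∧
        -- the closed-loop operator is well defined and stable with finite gain
        Converter.IsCausalOperator (Converter.closedLoop (p.op1 u₂) (p.sys2 u₁).op) ∧
        Converter.FiniteGainStable γ₀ β (Converter.closedLoop (p.op1 u₂) (p.sys2 u₁).op) ∧
        -- the affine bound for the solutions of the system
        (∀ x : ℝ → Fin 5 → ℝ, Converter.IsSolution (p.field I_L u₁ u₂) x →
          ∀ T : ℝ, 0 ≤ T →
            Converter.normT T (fun t => u₂ t * x t 2) ≤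
              γ * Converter.normT T (fun t => t / u₂ t) + β (Converter.splitState (x 0))) := by
  refine ⟨fun s hs => p.transferFunction_sys1 hs, fun s hs => p.tf1_den_ne_zero hs,
    p.positiveReal_tf1, fun s hs h => p.re_tf1_pos hs h, fun a _ => p.strictlyPositiveReal_A2 a,
    p.R₂, p.G, 1 / p.R₂, |I_L / p.C₂| / p.R₂ + 1, p.bias, one_div_pos.2 p.R₂_pos,
    add_pos_of_nonneg_of_pos (div_nonneg (abs_nonneg _) p.R₂_pos.le) one_pos, p.bias_pos,
    fun u₁ u₂ h₁ h₂ => ⟨p.isCausalOperator_op1 hum huM h₂, p.outputStrictlyPassive_op1 hum huM h₂,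
      p.isCausalOperator_sys2 h₁, fun e ξ he hξ T hT => p.sys2_energy he hξ hT,
      p.strictlyPassive_sys2, p.outputStrictlyPassive_sys2,
      fun x₀ v y z => p.feedbackLoop_extInput_iff hum huM h₂,
      p.isCausalOperator_closedLoop hum huM h₁ h₂, p.finiteGainStable_closedLoop hum huM h₂,
      fun x hx T hT => p.normT_output_le hum huM h₂ hx hT⟩⟩
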